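/- **Setting.** A monoidal signature $\Sigma$ consists of object symbols, morphism symbols, and for each morphism symbol $f$ a domain word $\mathrm{dom}(f)$ and a codomain word $\mathrm{cod}(f)$ in the object symbols. A dot-diagram $F$ over $\Sigma$ from a word $X$ to a word $Y$ consists of a finite set $B^F$ of boxes, each labelled by a morphism symbol $\ell_b(b)$, a finite set $D^F$ of dots, each labelled by an object symbol $\ell_d(d)$, and label-respecting wiring functions that assign a dot $\theta_{\mathrm{in}}(b,i)$ to the $i$-th input and a dot $\theta_{\mathrm{out}}(j,b)$ to the $j$-th output of every box $b$, and a dot to every diagram input (letter of $X$; assigned by $\theta_{\mathrm{in}}$) and to every diagram output (letter of $Y$; assigned by $\theta_{\mathrm{out}}$). It is closed if $X$ and $Y$ are empty, and simple if $\theta_{\mathrm{in}}$ and $\theta_{\mathrm{out}}$ are both surjective. $\mathbf{Dot}(\Sigma)$ is the hypergraph category whose objects are words and whose morphisms are isomorphism classes of dot-diagrams, with composition by pushout of dots along the common word, monoidal product by disjoint union, and Frobenius structure given by single dots (a hypergraph category is a symmetric monoidal category with a special commutative Frobenius algebra on every object, compatible with $\otimes$). For a commutative semiring $R$ (with $1$),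 $\mathrm{Mat}(R)$ is the hypergraph category whose objects are finite sets and whose morphisms $\mathcal I\to\mathcal J$ are the $R$-valued matrices $\psi_i^j$ ($i\in\mathcal I$, $j\in\mathcal J$), with $\mathcal I\otimes\mathcal J=\mathcal I\times\mathcal J$, the Kronecker product of matrices, and the Frobenius structure given by generalised Kronecker deltas. A hypergraph functor is a strong symmetric monoidal functor that preserves the Frobenius algebra of every object. **Theorem.** Let $\Sigma$ be a monoidal signature, $R$ a commutative semiring, $M:\mathbf{Dot}(\Sigma)\to\mathrm{Mat}(R)$ a hypergraph functor, and $F$ a closed simple dot-diagram, regarded as a morphism $F: I\to I$ of $\mathbf{Dot}(\Sigma)$. Let $\mathrm{Idx}(F,M)=\prod_{d\in D^F}M(\ell_d(d))$ be the set of functions $\phi$ that assign to each dot $d$ an element $\phi(d)$ of the finite set $M(\ell_d(d))$. Then $$M(F)=\sum_{\phi\in \mathrm{Idx}(F,M)}\ \prod_{b\in B^F} M(\ell_b(b))_{\phi(\theta_{\mathrm{in}}(b,1)),\dots,\phi(\theta_{\mathrm{in}}(b,m_b))}^{\phi(\theta_{\mathrm{out}}(1,b)),\dots,\phi(\theta_{\mathrm{out}}(n_b,b))}$$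 in $R$, where $m_b$ and $n_b$ are the lengths of $\mathrm{dom}(\ell_b(b))$ and $\mathrm{cod}(\ell_b(b))$. Here the coherence isomorphisms $M(I)\cong I$ and $M(A_1\cdots A_n)\cong M(A_1)\times\cdots\times M(A_n)$ of the strong monoidal functor $M$ are used to regard $M(F)$ as an element of $R$, and $M(f)$, for a morphism symbol $f:A_1\cdots A_m\to C_1\cdots C_n$, as a matrix with entries $M(f)_{x_1,\dots,x_m}^{y_1,\dots,y_n}\in R$, $x_i\in M(A_i)$, $y_j\in M(C_j)$. -/

import Mathlib

open CategoryTheory MonoidalCategory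

universe u v w z

/-- A monoidal signature: object symbols, and morphism symbols whose domain and codomain are words
in the object symbols. -/
structure MonoidalSignature where
  Obj : Type u
  Mor : Type v
  dom : Mor → List Obj
  cod : Mor → List Obj

/-- The positions of a word. -/
abbrev Pos {α : Type u} (X : List α) : Type := Fin X.length

namespace Pos

variable {α : Type u}

/-- The letter of a word at a position. -/
def letter (X : List α) (i : Pos X) : α := X.get i

/-- The positions of a concatenation: first those of `X`, then those of `Y`. -/
def join (X Y : List α) : Pos X ⊕ Pos Y ≃ Pos (X ++ Y) :=
  finSumFinEquiv.trans (finCongr List.length_append.symm)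

@[simp] theorem letter_join_inl {X Y : List α} (i : Pos X) :
    letter (X ++ Y) (join X Y (Sum.inl i)) = letter X i := by
  simp [join, letter]

@[simp] theorem letter_join_inr {X Y : List α} (i : Pos Y) :
    letter (X ++ Y) (join X Y (Sum.inr i)) = letter Y i := by
  simp [join, letter]

theorem join_cases {X Y : List α} {P : Pos (X ++ Y) → Prop}
    (hl : ∀ i, P (join X Y (Sum.inl i))) (hr : ∀ i, P (join X Y (Sum.inr i))) (i) : P i := by
  obtain ⟨s, rfl⟩ := (join X Y).surjective i
  cases s
  · exact hl _
  · exact hr _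

/-- Letter-preserving functions between the positions of two words. -/
structure Map (X Y : List α) where
  toFun : Pos X → Pos Y
  letter_toFun : ∀ i, letter Y (toFun i) = letter X i

namespace Map

instance {X Y : List α} : CoeFun (Map X Y) (fun _ => Pos X → Pos Y) := ⟨Map.toFun⟩

attribute [simp] letter_toFun

@[ext] theorem ext {X Y : List α} {r s : Map X Y} (h : ∀ i, r i = s i) : r = s := by
  cases r; cases s; congr; exact funext h

/-- The identity. -/
@[simps] def id (X : List α) : Map X X := ⟨fun i => i, fun _ => rfl⟩

/-- Composition, first `r`, then `s`. -/
@[simps] def comp {X Y Z : List α} (r : Map X Y) (s : Map Y Z) : Map X Z :=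
  ⟨fun i => s (r i), fun i => by simp⟩

/-- Concatenation. -/
@[simps] def sum {X Y X' Y' : List α} (r : Map X Y) (s : Map X' Y') : Map (X ++ X') (Y ++ Y') :=
  ⟨fun i => join Y Y' (Sum.map r s ((join X X').symm i)),
    join_cases (fun i => by simp) (fun i => by simp)⟩

/-- Case distinction. -/
@[simps] def elim {X Y Z : List α} (r : Map X Z) (s : Map Y Z) : Map (X ++ Y) Z :=
  ⟨fun i => Sum.elim r s ((join X Y).symm i), join_cases (fun i => by simp) (fun i => by simp)⟩

/-- The inclusion of the left factor. -/
@[simps] def inl (X Y : List α) : Map X (X ++ Y) := ⟨fun i => join X Y (Sum.inl i), by simp⟩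

/-- The inclusion of the right factor. -/
@[simps] def inr (X Y : List α) : Map Y (X ++ Y) := ⟨fun i => join X Y (Sum.inr i), by simp⟩

/-- The map out of the empty word. -/
def empty (X : List α) : Map [] X := ⟨fun i => i.elim0, fun i => i.elim0⟩

/-- Reassociation. -/
def assoc (X Y Z : List α) : Map ((X ++ Y) ++ Z) (X ++ (Y ++ Z)) :=
  elim (elim (inl _ _) ((inl _ _).comp (inr _ _))) ((inr _ _).comp (inr _ _))

/-- Reassociation, in the other direction. -/
def assocInv (X Y Z : List α) : Map (X ++ (Y ++ Z)) ((X ++ Y) ++ Z) :=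
  elim ((inl _ _).comp (inl _ _)) (elim ((inr _ _).comp (inl _ _)) (inr _ _))

/-- Swapping two words. -/
def swap (X Y : List α) : Map (X ++ Y) (Y ++ X) := elim (inr _ _) (inl _ _)

/-- Folding two copies of a word. -/
def fold (X : List α) : Map (X ++ X) X := elim (id X) (id X)

/-- Removing an empty word on the left. -/
def left (X : List α) : Map ([] ++ X) X := elim (empty X) (id X)

/-- Removing an empty word on the right. -/
def right (X : List α) : Map (X ++ []) X := elim (id X) (empty X)

end Map

end Pos

open Pos

namespace Pos.Map

variable {α : Type u}

theorem assoc_comp_assocInv (X Y Z : List α) :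
    (assoc X Y Z).comp (assocInv X Y Z) = id _ := by
  ext i; congr 1; revert i
  refine join_cases (join_cases (fun i => ?_) (fun i => ?_)) (fun i => ?_) <;>
    simp [assoc, assocInv]

theorem assocInv_comp_assoc (X Y Z : List α) :
    (assocInv X Y Z).comp (assoc X Y Z) = id _ := by
  ext i; congr 1; revert i
  refine join_cases (fun i => ?_) (join_cases (fun i => ?_) (fun i => ?_)) <;>
    simp [assoc, assocInv]

theorem swap_comp_swap (X Y : List α) : (swap X Y).comp (swap Y X) = id _ := by
  ext i; congr 1; revert i
  refine join_cases (fun i => ?_) (fun i => ?_) <;> simp [swap]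

theorem left_comp_inr (X : List α) : (left X).comp (inr [] X) = id _ := by
  ext i; congr 1; revert i
  refine join_cases (fun i => i.elim0) (fun i => ?_)
  simp [left]

theorem inr_comp_left (X : List α) : (inr [] X).comp (left X) = id _ := by
  ext i; simp [left]

theorem right_comp_inl (X : List α) : (right X).comp (inl X []) = id _ := by
  ext i; congr 1; revert i
  refine join_cases (fun i => ?_) (fun i => i.elim0)
  simp [right]

theorem inl_comp_right (X : List α) : (inl X []).comp (right X) = id _ := by
  ext i; simp [right]

theorem id_sum_id (X Y : List α) :
    (id X).sum (id Y) = id _ := by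
  ext i; congr 1; revert i
  refine join_cases (fun i => ?_) (fun i => ?_) <;> simp

theorem pentagon (W X Y Z : List α) :
    ((assoc W X Y).sum (id Z)).comp ((assoc W (X ++ Y) Z).comp ((id W).sum (assoc X Y Z))) =
      (assoc (W ++ X) Y Z).comp (assoc W X (Y ++ Z)) := by
  ext i; congr 1; revert i
  refine join_cases (join_cases (join_cases (fun i => ?_) (fun i => ?_)) (fun i => ?_)) (fun i => ?_) <;> simp [assoc]

theorem triangle (X Y : List α) :
    (assoc X [] Y).comp ((id X).sum (left Y)) = (right X).sum (id Y) := by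
  ext i; congr 1; revert i
  refine join_cases (join_cases (fun i => ?_) (fun i => i.elim0)) (fun i => ?_) <;> simp [assoc, left, right]

theorem hexagon (X Y Z : List α) :
    (assoc X Y Z).comp ((swap X (Y ++ Z)).comp (assoc Y Z X)) =
      ((swap X Y).sum (id Z)).comp ((assoc Y X Z).comp ((id Y).sum (swap X Z))) := by
  ext i; congr 1; revert i
  refine join_cases (join_cases (fun i => ?_) (fun i => ?_)) (fun i => ?_) <;> simp [assoc, swap]

theorem hexagon' (X Y Z : List α) :
    (assocInv X Y Z).comp ((swap (X ++ Y) Z).comp (assocInv Z X Y)) =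
      ((id X).sum (swap Y Z)).comp ((assocInv X Z Y).comp ((swap X Z).sum (id Y))) := by
  ext i; congr 1; revert i
  refine join_cases (fun i => ?_) (join_cases (fun i => ?_) (fun i => ?_)) <;> simp [assocInv, swap]

/-- The middle interchange. -/
def shuffle (X Y Z W : List α) : Map ((X ++ Y) ++ (Z ++ W)) ((X ++ Z) ++ (Y ++ W)) :=
  elim (elim ((inl _ _).comp (inl _ _)) ((inl _ _).comp (inr _ _)))
    (elim ((inr _ _).comp (inl _ _)) ((inr _ _).comp (inr _ _)))

theorem shuffle_eq (X Y Z W : List α) :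
    (assoc X Y (Z ++ W)).comp (((id X).sum (assocInv Y Z W)).comp
      (((id X).sum ((swap Y Z).sum (id W))).comp (((id X).sum (assoc Z Y W)).comp
        (assocInv X Z (Y ++ W))))) = shuffle X Y Z W := by
  ext i; congr 1; revert i
  refine join_cases (join_cases (fun i => ?_) (fun i => ?_)) (join_cases (fun i => ?_) (fun i => ?_)) <;> simp [assoc, assocInv, swap, shuffle]

theorem shuffle_shuffle (X Y Z W : List α) :
    (shuffle X Y Z W).comp (shuffle X Z Y W) = id _ := by
  ext i; congr 1; revert i
  refine join_cases (join_cases (fun i => ?_) (fun i => ?_)) (join_cases (fun i => ?_) (fun i => ?_)) <;> simp [shuffle]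

theorem one_mul (X : List α) :
    ((empty X).sum (id X)).comp (fold X) = left X := by
  ext i; congr 1; revert i
  refine join_cases (fun i => i.elim0) (fun i => ?_)
  simp [fold, left]

theorem mul_one (X : List α) :
    ((id X).sum (empty X)).comp (fold X) = right X := by
  ext i; congr 1; revert i
  refine join_cases (fun i => ?_) (fun i => i.elim0)
  simp [fold, right]

theorem mul_assoc (X : List α) :
    ((fold X).sum (id X)).comp (fold X) =
      (assoc X X X).comp (((id X).sum (fold X)).comp (fold X)) := by
  ext i; congr 1; revert i
  refine join_cases (join_cases (fun i => ?_) (fun i => ?_)) (fun i => ?_) <;> simp [fold, assoc]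

theorem mul_assoc' (X : List α) :
    ((id X).sum (fold X)).comp (fold X) =
      ((assocInv X X X).comp ((fold X).sum (id X))).comp (fold X) := by
  ext i; congr 1; revert i
  refine join_cases (fun i => ?_) (join_cases (fun i => ?_) (fun i => ?_)) <;> simp [fold, assocInv]

theorem mul_comm (X : List α) :
    (swap X X).comp (fold X) = fold X := by
  ext i; congr 1; revert i
  refine join_cases (fun i => ?_) (fun i => ?_) <;> simp [fold, swap]

theorem mul_tensor (X Y : List α) :
    (shuffle X Y X Y).comp ((fold X).sum (fold Y)) = fold (X ++ Y) := by
  ext i; congr 1; revert i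
  refine join_cases (join_cases (fun i => ?_) (fun i => ?_)) (join_cases (fun i => ?_) (fun i => ?_)) <;> simp [fold, shuffle]

theorem one_tensor (X Y : List α) :
    (inr [] []).comp ((empty X).sum (empty Y)) = empty (X ++ Y) := by
  ext i; exact i.elim0

theorem one_tensor' (X Y : List α) :
    (left []).comp (empty (X ++ Y)) = (empty X).sum (empty Y) := by
  ext i; congr 1; revert i
  refine join_cases (fun i => i.elim0) (fun i => i.elim0)

end Pos.Map

/-- A dot-diagram with input word `X` and output word `Y`: finitely many boxes labelled by morphism
symbols and finitely many dots labelled by object symbols; every input and output of a box, every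
diagram input and every diagram output is wired to a dot with the right label. The diagram inputs
and outputs are the positions of `X` and `Y`. -/
structure DotDiagram (S : MonoidalSignature.{u, v}) (X Y : List S.Obj) where
  Box : Type
  Dot : Type
  finite_box : Finite Box
  finite_dot : Finite Dot
  boxLabel : Box → S.Mor
  dotLabel : Dot → S.Obj
  boxIn : (b : Box) → Pos (S.dom (boxLabel b)) → Dot
  boxOut : (b : Box) → Pos (S.cod (boxLabel b)) → Dot
  inp : Pos X → Dot
  out : Pos Y → Dot
  dotLabel_boxIn : ∀ b i, dotLabel (boxIn b i) = letter (S.dom (boxLabel b)) i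
  dotLabel_boxOut : ∀ b j, dotLabel (boxOut b j) = letter (S.cod (boxLabel b)) j
  dotLabel_inp : ∀ i, dotLabel (inp i) = letter X i
  dotLabel_out : ∀ j, dotLabel (out j) = letter Y j

namespace DotDiagram

variable {S : MonoidalSignature.{u, v}} {X Y Z X' Y' Z' X'' Y'' : List S.Obj}

attribute [instance] finite_box finite_dot
attribute [simp] dotLabel_boxIn dotLabel_boxOut dotLabel_inp dotLabel_out

/-- All inputs of a diagram: those of its boxes and the diagram inputs. -/
abbrev Inputs (F : DotDiagram S X Y) : Type :=
  (Σ b : F.Box, Pos (S.dom (F.boxLabel b))) ⊕ Pos X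

/-- All outputs of a diagram: those of its boxes and the diagram outputs. -/
abbrev Outputs (F : DotDiagram S X Y) : Type :=
  (Σ b : F.Box, Pos (S.cod (F.boxLabel b))) ⊕ Pos Y

/-- The input wiring function. -/
def wireIn (F : DotDiagram S X Y) : F.Inputs → F.Dot :=
  Sum.elim (fun p => F.boxIn p.1 p.2) F.inp

/-- The output wiring function. -/
def wireOut (F : DotDiagram S X Y) : F.Outputs → F.Dot :=
  Sum.elim (fun p => F.boxOut p.1 p.2) F.out

/-- A dot-diagram is simple if both wiring functions are surjective. -/
def IsSimple (F : DotDiagram S X Y) : Prop :=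
  Function.Surjective F.wireIn ∧ Function.Surjective F.wireOut

/-- Isomorphisms of dot-diagrams. -/
structure Iso (F G : DotDiagram S X Y) where
  box : F.Box ≃ G.Box
  dot : F.Dot ≃ G.Dot
  boxLabel : ∀ b, G.boxLabel (box b) = F.boxLabel b
  dotLabel : ∀ d, G.dotLabel (dot d) = F.dotLabel d
  boxIn : ∀ b i, G.boxIn (box b) (Fin.cast (by rw [boxLabel]) i) = dot (F.boxIn b i)
  boxOut : ∀ b j, G.boxOut (box b) (Fin.cast (by rw [boxLabel]) j) = dot (F.boxOut b j)
  inp : ∀ i, G.inp i = dot (F.inp i)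
  out : ∀ j, G.out j = dot (F.out j)

theorem boxIn_congr (F : DotDiagram S X Y) {b b' : F.Box} (h : b = b')
    {i : Pos (S.dom (F.boxLabel b))} {i' : Pos (S.dom (F.boxLabel b'))}
    (hi : (i : ℕ) = i') : F.boxIn b i = F.boxIn b' i' := by
  subst h; rw [Fin.ext hi]

theorem boxOut_congr (F : DotDiagram S X Y) {b b' : F.Box} (h : b = b')
    {i : Pos (S.cod (F.boxLabel b))} {i' : Pos (S.cod (F.boxLabel b'))}
    (hi : (i : ℕ) = i') : F.boxOut b i = F.boxOut b' i' := by
  subst h; rw [Fin.ext hi]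

namespace Iso

/-- The identity isomorphism. -/
def refl (F : DotDiagram S X Y) : Iso F F :=
  ⟨.refl _, .refl _, fun _ => rfl, fun _ => rfl, fun _ _ => rfl, fun _ _ => rfl, fun _ => rfl,
    fun _ => rfl⟩

/-- The inverse isomorphism. -/
def symm {F G : DotDiagram S X Y} (e : Iso F G) : Iso G F where
  box := e.box.symm
  dot := e.dot.symm
  boxLabel b := by rw [← e.boxLabel, Equiv.apply_symm_apply]
  dotLabel d := by rw [← e.dotLabel, Equiv.apply_symm_apply]
  boxIn b i := by
    rw [Equiv.eq_symm_apply, ← e.boxIn]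
    exact G.boxIn_congr (by simp) (by simp)
  boxOut b i := by
    rw [Equiv.eq_symm_apply, ← e.boxOut]
    exact G.boxOut_congr (by simp) (by simp)
  inp i := by rw [Equiv.eq_symm_apply, e.inp]
  out i := by rw [Equiv.eq_symm_apply, e.out]

/-- Composition of isomorphisms. -/
def trans {F G H : DotDiagram S X Y} (e : Iso F G) (e' : Iso G H) : Iso F H where
  box := e.box.trans e'.box
  dot := e.dot.trans e'.dot
  boxLabel b := by simp [e.boxLabel, e'.boxLabel]
  dotLabel d := by simp [e.dotLabel, e'.dotLabel]
  boxIn b i := by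
    simp only [Equiv.trans_apply, ← e.boxIn, ← e'.boxIn]
    exact H.boxIn_congr rfl rfl
  boxOut b i := by
    simp only [Equiv.trans_apply, ← e.boxOut, ← e'.boxOut]
    exact H.boxOut_congr rfl rfl
  inp i := by simp [e.inp, e'.inp]
  out i := by simp [e.out, e'.out]

end Iso

/-- Isomorphism is an equivalence relation. -/
instance setoid (S : MonoidalSignature.{u, v}) (X Y : List S.Obj) : Setoid (DotDiagram S X Y) where
  r F G := Nonempty (Iso F G)
  iseqv := ⟨fun F => ⟨.refl F⟩, fun ⟨e⟩ => ⟨e.symm⟩, fun ⟨e⟩ ⟨e'⟩ => ⟨e.trans e'⟩⟩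

/-- The gluing relation of a composite: the `j`-th output dot of `F` is the `j`-th input dot
of `G`. -/
inductive Glue (F : DotDiagram S X Y) (G : DotDiagram S Y Z) : F.Dot ⊕ G.Dot → F.Dot ⊕ G.Dot → Prop
  | mk (j : Pos Y) : Glue F G (Sum.inl (F.out j)) (Sum.inr (G.inp j))

theorem Glue.dotLabel_eq {F : DotDiagram S X Y} {G : DotDiagram S Y Z} {x y : F.Dot ⊕ G.Dot}
    (h : Glue F G x y) : Sum.elim F.dotLabel G.dotLabel x = Sum.elim F.dotLabel G.dotLabel y := by
  cases h; simp

/-- Composition, first `F`, then `G`: the dots are the pushout of the dots of `F` and of `G` over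
the positions of the common word. -/
@[simps] abbrev comp (F : DotDiagram S X Y) (G : DotDiagram S Y Z) : DotDiagram S X Z where
  Box := F.Box ⊕ G.Box
  Dot := Quot (Glue F G)
  finite_box := inferInstance
  finite_dot := inferInstance
  boxLabel := Sum.elim F.boxLabel G.boxLabel
  dotLabel := Quot.lift (Sum.elim F.dotLabel G.dotLabel) fun _ _ h => h.dotLabel_eq
  boxIn
    | Sum.inl b, i => Quot.mk _ (Sum.inl (F.boxIn b i))
    | Sum.inr b, i => Quot.mk _ (Sum.inr (G.boxIn b i))
  boxOut
    | Sum.inl b, j => Quot.mk _ (Sum.inl (F.boxOut b j))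
    | Sum.inr b, j => Quot.mk _ (Sum.inr (G.boxOut b j))
  inp i := Quot.mk _ (Sum.inl (F.inp i))
  out j := Quot.mk _ (Sum.inr (G.out j))
  dotLabel_boxIn := by
    rintro (b | b) i
    · exact F.dotLabel_boxIn b i
    · exact G.dotLabel_boxIn b i
  dotLabel_boxOut := by
    rintro (b | b) i
    · exact F.dotLabel_boxOut b i
    · exact G.dotLabel_boxOut b i
  dotLabel_inp i := by simp
  dotLabel_out i := by simp

/-- The monoidal product: disjoint union. -/
@[simps] abbrev tensor (F : DotDiagram S X Y) (G : DotDiagram S X' Y') :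
    DotDiagram S (X ++ X') (Y ++ Y') where
  Box := F.Box ⊕ G.Box
  Dot := F.Dot ⊕ G.Dot
  finite_box := inferInstance
  finite_dot := inferInstance
  boxLabel := Sum.elim F.boxLabel G.boxLabel
  dotLabel := Sum.elim F.dotLabel G.dotLabel
  boxIn
    | Sum.inl b, i => Sum.inl (F.boxIn b i)
    | Sum.inr b, i => Sum.inr (G.boxIn b i)
  boxOut
    | Sum.inl b, j => Sum.inl (F.boxOut b j)
    | Sum.inr b, j => Sum.inr (G.boxOut b j)
  inp i := Sum.map F.inp G.inp ((join X X').symm i)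
  out j := Sum.map F.out G.out ((join Y Y').symm j)
  dotLabel_boxIn := by
    rintro (b | b) i
    · exact F.dotLabel_boxIn b i
    · exact G.dotLabel_boxIn b i
  dotLabel_boxOut := by
    rintro (b | b) i
    · exact F.dotLabel_boxOut b i
    · exact G.dotLabel_boxOut b i
  dotLabel_inp := join_cases (fun i => by simp) (fun i => by simp)
  dotLabel_out := join_cases (fun i => by simp) (fun i => by simp)

/-- The box-free diagram with one dot for each position of `Y`, the diagram outputs being wired
to their own dots and the diagram inputs along `r`. -/
@[simps] abbrev fn (r : Map X Y) : DotDiagram S X Y where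
  Box := Empty
  Dot := Pos Y
  finite_box := inferInstance
  finite_dot := inferInstance
  boxLabel := Empty.elim
  dotLabel := letter Y
  boxIn b := b.elim
  boxOut b := b.elim
  inp := r
  out j := j
  dotLabel_boxIn b := b.elim
  dotLabel_boxOut b := b.elim
  dotLabel_inp i := by simp
  dotLabel_out j := rfl

/-- The box-free diagram with one dot for each position of `X`, the diagram inputs being wired
to their own dots and the diagram outputs along `r`. -/
@[simps] abbrev cofn (r : Map Y X) : DotDiagram S X Y where
  Box := Empty
  Dot := Pos X
  finite_box := inferInstance
  finite_dot := inferInstance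
  boxLabel := Empty.elim
  dotLabel := letter X
  boxIn b := b.elim
  boxOut b := b.elim
  inp i := i
  out := r
  dotLabel_boxIn b := b.elim
  dotLabel_boxOut b := b.elim
  dotLabel_inp i := rfl
  dotLabel_out j := by simp

/-- The diagram of a morphism symbol: a single box, each of whose inputs and outputs is wired
through a dot of its own to the corresponding diagram input or output. -/
@[simps] abbrev box (S : MonoidalSignature.{u, v}) (f : S.Mor) : DotDiagram S (S.dom f) (S.cod f) where
  Box := Unit
  Dot := Pos (S.dom f) ⊕ Pos (S.cod f)
  finite_box := inferInstance
  finite_dot := inferInstance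
  boxLabel _ := f
  dotLabel := Sum.elim (letter (S.dom f)) (letter (S.cod f))
  boxIn _ i := Sum.inl i
  boxOut _ j := Sum.inr j
  inp i := Sum.inl i
  out j := Sum.inr j
  dotLabel_boxIn _ _ := rfl
  dotLabel_boxOut _ _ := rfl
  dotLabel_inp _ := rfl
  dotLabel_out _ := rfl

/-- Rewiring the diagram inputs along `r`. -/
@[simps] abbrev pre (r : Map X Y) (G : DotDiagram S Y Z) : DotDiagram S X Z where
  __ := G
  inp i := G.inp (r i)
  dotLabel_inp i := by simp

/-- Rewiring the diagram outputs along `r`. -/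
@[simps] abbrev post (F : DotDiagram S X Y) (r : Map Z Y) : DotDiagram S X Z where
  __ := F
  out i := F.out (r i)
  dotLabel_out i := by simp

/-- Recognition of a composite: `h` exhibits the dots of `H` as the pushout. -/
noncomputable def compIso {F : DotDiagram S X Y} {G : DotDiagram S Y Z} {H : DotDiagram S X Z}
    (e : F.Box ⊕ G.Box ≃ H.Box) (h : F.Dot ⊕ G.Dot → H.Dot) (k : H.Dot → Quot (Glue F G))
    (hglue : ∀ j, h (Sum.inl (F.out j)) = h (Sum.inr (G.inp j)))
    (hsurj : Function.Surjective h) (hk : ∀ x, k (h x) = Quot.mk _ x)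
    (hbox : ∀ b, H.boxLabel (e b) = Sum.elim F.boxLabel G.boxLabel b)
    (hdot : ∀ d, H.dotLabel (h d) = Sum.elim F.dotLabel G.dotLabel d)
    (hinl : ∀ b (i : Pos (S.dom (F.boxLabel b))),
      H.boxIn (e (Sum.inl b)) (Fin.cast (by rw [hbox]; rfl) i) = h (Sum.inl (F.boxIn b i)))
    (hinr : ∀ b (i : Pos (S.dom (G.boxLabel b))),
      H.boxIn (e (Sum.inr b)) (Fin.cast (by rw [hbox]; rfl) i) = h (Sum.inr (G.boxIn b i)))
    (houtl : ∀ b (i : Pos (S.cod (F.boxLabel b))),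
      H.boxOut (e (Sum.inl b)) (Fin.cast (by rw [hbox]; rfl) i) = h (Sum.inl (F.boxOut b i)))
    (houtr : ∀ b (i : Pos (S.cod (G.boxLabel b))),
      H.boxOut (e (Sum.inr b)) (Fin.cast (by rw [hbox]; rfl) i) = h (Sum.inr (G.boxOut b i)))
    (hinp : ∀ i, H.inp i = h (Sum.inl (F.inp i)))
    (hout : ∀ i, H.out i = h (Sum.inr (G.out i))) : Iso (comp F G) H where
  box := e
  dot :=
    { toFun := Quot.lift h (by rintro _ _ ⟨j⟩; exact hglue j)
      invFun := k
      left_inv := by rintro ⟨x⟩; exact hk x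
      right_inv := by
        intro d; obtain ⟨x, rfl⟩ := hsurj d; rw [hk] }
  boxLabel := hbox
  dotLabel := by rintro ⟨d⟩; exact hdot d
  boxIn := by
    rintro (b | b) i
    · exact hinl b i
    · exact hinr b i
  boxOut := by
    rintro (b | b) i
    · exact houtl b i
    · exact houtr b i
  inp := hinp
  out := hout

theorem mk_glue (F : DotDiagram S X Y) (G : DotDiagram S Y Z) (j : Pos Y) :
    (Quot.mk (Glue F G) (Sum.inl (F.out j))) = Quot.mk _ (Sum.inr (G.inp j)) :=
  Quot.sound (.mk j)

theorem fn_comp (r : Map X Y) (G : DotDiagram S Y Z) : comp (fn r) G ≈ pre r G := by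
  refine ⟨compIso (Equiv.emptySum Empty _) (Sum.elim G.inp id) (fun d => Quot.mk _ (Sum.inr d))
    (fun j => rfl) (fun d => ⟨Sum.inr d, rfl⟩) ?_ ?_ ?_ ?_ ?_ ?_ ?_ ?_ ?_⟩
  · rintro (d | d)
    · exact (mk_glue (fn r) G d).symm
    · rfl
  · rintro (b | b)
    · exact b.elim
    · rfl
  · rintro (d | d)
    · exact G.dotLabel_inp d
    · rfl
  all_goals intros
  all_goals first | rfl | exact Empty.elim (by assumption)

theorem comp_cofn (F : DotDiagram S X Y) (r : Map Z Y) : comp F (cofn r) ≈ post F r := by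
  refine ⟨compIso (Equiv.sumEmpty _ Empty) (Sum.elim id F.out) (fun d => Quot.mk _ (Sum.inl d))
    (fun j => rfl) (fun d => ⟨Sum.inl d, rfl⟩) ?_ ?_ ?_ ?_ ?_ ?_ ?_ ?_ ?_⟩
  · rintro (d | d)
    · rfl
    · exact (mk_glue F (cofn r) d)
  · rintro (b | b)
    · rfl
    · exact b.elim
  · rintro (d | d)
    · rfl
    · exact F.dotLabel_out d
  all_goals intros
  all_goals first | rfl | exact Empty.elim (by assumption)

theorem comp_congr {F F' : DotDiagram S X Y} {G G' : DotDiagram S Y Z} (hF : F ≈ F') (hG : G ≈ G') :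
    comp F G ≈ comp F' G' := by
  obtain ⟨e⟩ := hF
  obtain ⟨e'⟩ := hG
  refine ⟨compIso (Equiv.sumCongr e.box e'.box) (fun x => Quot.mk _ (Sum.map e.dot e'.dot x))
    (Quot.map (Sum.map e.dot.symm e'.dot.symm) ?_) ?_ ?_ ?_ ?_ ?_ ?_ ?_ ?_ ?_ ?_ ?_⟩
  · rintro _ _ ⟨j⟩
    have := Glue.mk (F := F) (G := G) j
    simpa [e.out, e'.inp] using this
  · intro j
    simpa [e.out, e'.inp] using mk_glue F' G' j
  · rintro ⟨x⟩
    exact ⟨Sum.map e.dot.symm e'.dot.symm x, by rcases x with x | x <;> simp⟩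
  · rintro (x | x) <;> simp [Quot.map]
  · rintro (x | x) <;> simp [e.boxLabel, e'.boxLabel]
  · rintro (x | x) <;> simp [e.dotLabel, e'.dotLabel]
  · intro b i; exact congrArg (fun x => Quot.mk _ (Sum.inl x)) (e.boxIn b i)
  · intro b i; exact congrArg (fun x => Quot.mk _ (Sum.inr x)) (e'.boxIn b i)
  · intro b i; exact congrArg (fun x => Quot.mk _ (Sum.inl x)) (e.boxOut b i)
  · intro b i; exact congrArg (fun x => Quot.mk _ (Sum.inr x)) (e'.boxOut b i)
  · intro i; simp [e.inp]
  · intro i; simp [e'.out]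

theorem comp_assoc {W : List S.Obj} (F : DotDiagram S W X) (G : DotDiagram S X Y)
    (H : DotDiagram S Y Z) : comp (comp F G) H ≈ comp F (comp G H) := by
  refine ⟨compIso (Equiv.sumAssoc _ _ _)
    (Sum.elim (Quot.lift (fun x => Quot.mk _ (Sum.map id (fun d => Quot.mk _ (Sum.inl d)) x)) ?_)
      (fun d => Quot.mk _ (Sum.inr (Quot.mk _ (Sum.inr d)))))
    (Quot.lift (Sum.elim (fun d => Quot.mk _ (Sum.inl (Quot.mk _ (Sum.inl d))))
      (Quot.lift (fun x => Quot.mk _ (Sum.map (fun d => Quot.mk _ (Sum.inr d)) id x)) ?_)) ?_)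
    ?_ ?_ ?_ ?_ ?_ ?_ ?_ ?_ ?_ ?_ ?_⟩
  · rintro _ _ ⟨j⟩
    exact mk_glue F (comp G H) j
  · rintro _ _ ⟨j⟩
    exact mk_glue (comp F G) H j
  · rintro _ _ ⟨j⟩
    exact congrArg (fun x => Quot.mk _ (Sum.inl x)) (mk_glue F G j)
  · intro j
    exact congrArg (fun x => Quot.mk _ (Sum.inr x)) (mk_glue G H j)
  · rintro ⟨x⟩
    rcases x with x | q
    · exact ⟨Sum.inl (Quot.mk _ (Sum.inl x)), rfl⟩
    · obtain ⟨y, rfl⟩ := Quot.exists_rep q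
      rcases y with x | x
      · exact ⟨Sum.inl (Quot.mk _ (Sum.inr x)), rfl⟩
      · exact ⟨Sum.inr x, rfl⟩
  · rintro (q | x)
    · obtain ⟨y, rfl⟩ := Quot.exists_rep q
      rcases y with x | x <;> rfl
    · rfl
  · rintro ((b | b) | b) <;> rfl
  · rintro (q | x)
    · obtain ⟨y, rfl⟩ := Quot.exists_rep q
      rcases y with x | x <;> rfl
    · rfl
  · rintro (b | b) i <;> rfl
  · intro b i; rfl
  · rintro (b | b) i <;> rfl
  · intro b i; rfl
  · intro i; rfl
  · intro i; rfl

theorem tensor_congr {F F' : DotDiagram S X Y} {G G' : DotDiagram S X' Y'} (hF : F ≈ F')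
    (hG : G ≈ G') : tensor F G ≈ tensor F' G' := by
  obtain ⟨e⟩ := hF
  obtain ⟨e'⟩ := hG
  refine ⟨⟨Equiv.sumCongr e.box e'.box, Equiv.sumCongr e.dot e'.dot, ?_, ?_, ?_, ?_, ?_, ?_⟩⟩
  · rintro (x | x) <;> simp [e.boxLabel, e'.boxLabel]
  · rintro (x | x) <;> simp [e.dotLabel, e'.dotLabel]
  · rintro (b | b) i
    · exact congrArg Sum.inl (e.boxIn b i)
    · exact congrArg Sum.inr (e'.boxIn b i)
  · rintro (b | b) i
    · exact congrArg Sum.inl (e.boxOut b i)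
    · exact congrArg Sum.inr (e'.boxOut b i)
  · exact join_cases (fun i => by simp [e.inp]) (fun i => by simp [e'.inp])
  · exact join_cases (fun i => by simp [e.out]) (fun i => by simp [e'.out])

theorem tensor_comp (F : DotDiagram S X Y) (F' : DotDiagram S X' Y') (G : DotDiagram S Y Z)
    (G' : DotDiagram S Y' Z') :
    comp (tensor F F') (tensor G G') ≈ tensor (comp F G) (comp F' G') := by
  refine ⟨compIso (Equiv.sumSumSumComm _ _ _ _)
    (fun x => Sum.map (Quot.mk _) (Quot.mk _) (Equiv.sumSumSumComm _ _ _ _ x))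
    (Sum.elim (Quot.map (Sum.map Sum.inl Sum.inl) ?_) (Quot.map (Sum.map Sum.inr Sum.inr) ?_))
    ?_ ?_ ?_ ?_ ?_ ?_ ?_ ?_ ?_ ?_ ?_⟩
  · rintro _ _ ⟨j⟩
    simpa using Glue.mk (F := tensor F F') (G := tensor G G') (join Y Y' (Sum.inl j))
  · rintro _ _ ⟨j⟩
    simpa using Glue.mk (F := tensor F F') (G := tensor G G') (join Y Y' (Sum.inr j))
  · refine join_cases (fun i => ?_) (fun i => ?_)
    · simpa using mk_glue F G i
    · simpa using mk_glue F' G' i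
  · rintro (q | q) <;> obtain ⟨y, rfl⟩ := Quot.exists_rep q <;> rcases y with x | x
    · exact ⟨Sum.inl (Sum.inl x), rfl⟩
    · exact ⟨Sum.inr (Sum.inl x), rfl⟩
    · exact ⟨Sum.inl (Sum.inr x), rfl⟩
    · exact ⟨Sum.inr (Sum.inr x), rfl⟩
  · rintro ((x | x) | (x | x)) <;> rfl
  · rintro ((x | x) | (x | x)) <;> rfl
  · rintro ((x | x) | (x | x)) <;> rfl
  · rintro (b | b) i <;> rfl
  · rintro (b | b) i <;> rfl
  · rintro (b | b) i <;> rfl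
  · rintro (b | b) i <;> rfl
  · exact join_cases (fun i => by simp) (fun i => by simp)
  · exact join_cases (fun i => by simp) (fun i => by simp)

theorem tensor_fn (r : Map X Y) (s : Map X' Y') :
    tensor (fn r : DotDiagram S X Y) (fn s) ≈ fn (r.sum s) := by
  refine ⟨⟨Equiv.emptySum Empty Empty, join Y Y', ?_, ?_, ?_, ?_, ?_, ?_⟩⟩
  · rintro (b | b) <;> exact b.elim
  · rintro (x | x) <;> simp
  · rintro (b | b) <;> exact b.elim
  · rintro (b | b) <;> exact b.elim
  · exact join_cases (fun i => by simp) (fun i => by simp)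
  · exact join_cases (fun i => by simp) (fun i => by simp)

theorem tensor_cofn (r : Map Y X) (s : Map Y' X') :
    tensor (cofn r : DotDiagram S X Y) (cofn s) ≈ cofn (r.sum s) := by
  refine ⟨⟨Equiv.emptySum Empty Empty, join X X', ?_, ?_, ?_, ?_, ?_, ?_⟩⟩
  · rintro (b | b) <;> exact b.elim
  · rintro (x | x) <;> simp
  · rintro (b | b) <;> exact b.elim
  · rintro (b | b) <;> exact b.elim
  · exact join_cases (fun i => by simp) (fun i => by simp)
  · exact join_cases (fun i => by simp) (fun i => by simp)

theorem fn_equiv_cofn (r : Map X Y) (s : Map Y X) (hr : ∀ i, s (r i) = i) (hs : ∀ i, r (s i) = i) :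
    (fn r : DotDiagram S X Y) ≈ cofn s := by
  refine ⟨⟨.refl _, ⟨s, r, hs, hr⟩, ?_, ?_, ?_, ?_, ?_, ?_⟩⟩
  · exact fun b => b.elim
  · intro d; simp
  · exact fun b => b.elim
  · exact fun b => b.elim
  · intro i; simp [hr]
  · intro i; rfl

theorem assoc_nat (F : DotDiagram S X X') (G : DotDiagram S Y Y') (H : DotDiagram S Z Z') :
    post (tensor (tensor F G) H) (Map.assocInv X' Y' Z') ≈
      pre (Map.assoc X Y Z) (tensor F (tensor G H)) := by
  refine ⟨⟨Equiv.sumAssoc _ _ _, Equiv.sumAssoc _ _ _, ?_, ?_, ?_, ?_, ?_, ?_⟩⟩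
  · rintro ((b | b) | b) <;> rfl
  · rintro ((b | b) | b) <;> rfl
  · rintro ((b | b) | b) i <;> rfl
  · rintro ((b | b) | b) i <;> rfl
  · refine join_cases (join_cases (fun i => ?_) (fun i => ?_)) (fun i => ?_) <;> simp [Map.assoc]
  · refine join_cases (fun i => ?_) (join_cases (fun i => ?_) (fun i => ?_)) <;>
      simp [Map.assocInv]

theorem swap_nat (F : DotDiagram S X X') (G : DotDiagram S Y Y') :
    post (tensor F G) (Map.swap Y' X') ≈ pre (Map.swap X Y) (tensor G F) := by
  refine ⟨⟨Equiv.sumComm _ _, Equiv.sumComm _ _, ?_, ?_, ?_, ?_, ?_, ?_⟩⟩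
  · rintro (b | b) <;> rfl
  · rintro (b | b) <;> rfl
  · rintro (b | b) i <;> rfl
  · rintro (b | b) i <;> rfl
  · refine join_cases (fun i => ?_) (fun i => ?_) <;> simp [Map.swap]
  · refine join_cases (fun i => ?_) (fun i => ?_) <;> simp [Map.swap]

theorem left_nat (F : DotDiagram S X X') :
    post (tensor (fn (Map.id [])) F) (Map.inr [] X') ≈ pre (Map.left X) F := by
  refine ⟨⟨Equiv.emptySum Empty _, Equiv.emptySum (Fin 0) _, ?_, ?_, ?_, ?_, ?_, ?_⟩⟩
  · rintro (b | b)
    · exact b.elim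
    · rfl
  · rintro (b | b)
    · exact b.elim0
    · rfl
  · rintro (b | b) i
    · exact b.elim
    · rfl
  · rintro (b | b) i
    · exact b.elim
    · rfl
  · refine join_cases (fun i => i.elim0) (fun i => ?_)
    simp [Map.left]
  · intro i; simp

theorem right_nat (F : DotDiagram S X X') :
    post (tensor F (fn (Map.id []))) (Map.inl X' []) ≈ pre (Map.right X) F := by
  refine ⟨⟨Equiv.sumEmpty _ Empty, Equiv.sumEmpty _ (Fin 0), ?_, ?_, ?_, ?_, ?_, ?_⟩⟩
  · rintro (b | b)
    · rfl
    · exact b.elim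
  · rintro (b | b)
    · rfl
    · exact b.elim0
  · rintro (b | b) i
    · rfl
    · exact b.elim
  · rintro (b | b) i
    · rfl
    · exact b.elim
  · refine join_cases (fun i => ?_) (fun i => i.elim0)
    simp [Map.right]
  · intro i; simp

/-- A pushout square of positions computes the composite of a `cofn` with an `fn`. -/
theorem cofn_comp_fn (r : Map Y X) (s : Map Y Z) (p : Map X X') (q : Map Z X')
    (hpq : ∀ i, p (r i) = q (s i)) (k : Pos X' → Quot (Glue (cofn r : DotDiagram S X Y) (fn s)))
    (hsurj : Function.Surjective (Sum.elim p q)) (hkp : ∀ i, k (p i) = Quot.mk _ (Sum.inl i))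
    (hkq : ∀ i, k (q i) = Quot.mk _ (Sum.inr i)) :
    comp (cofn r : DotDiagram S X Y) (fn s) ≈ comp (fn p) (cofn q) := by
  refine Setoid.trans (b := post (fn p) q) ?_ (Setoid.symm (comp_cofn _ _))
  refine ⟨compIso (Equiv.emptySum Empty Empty) (Sum.elim p q) k hpq hsurj ?_ ?_ ?_ ?_ ?_ ?_ ?_ ?_ ?_⟩
  · rintro (x | x)
    · exact hkp x
    · exact hkq x
  · rintro (b | b) <;> exact b.elim
  · rintro (x | x) <;> simp
  all_goals intros
  all_goals first | rfl | exact Empty.elim (by assumption)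

theorem special (X : List S.Obj) :
    comp (cofn (Map.fold X) : DotDiagram S X (X ++ X)) (fn (Map.fold X)) ≈
      comp (fn (Map.id X)) (cofn (Map.id X)) := by
  refine cofn_comp_fn _ _ _ _ (fun i => rfl) (fun i => Quot.mk _ (Sum.inl i))
    (fun i => ⟨Sum.inl i, rfl⟩) (fun i => rfl) (fun i => ?_)
  have := mk_glue (cofn (Map.fold X) : DotDiagram S X (X ++ X)) (fn (Map.fold X))
    (join X X (Sum.inl i))
  simpa [Map.fold] using this

theorem frobenius (X : List S.Obj) :
    let F : DotDiagram S (X ++ X) ((X ++ X) ++ X) := cofn ((Map.fold X).sum (Map.id X))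
    let G : DotDiagram S ((X ++ X) ++ X) (X ++ X) :=
      fn ((Map.assoc X X X).comp ((Map.id X).sum (Map.fold X)))
    comp F G ≈ comp (fn (Map.fold X)) (cofn (Map.fold X)) := by
  intro F G
  have h1 : ∀ i : Pos X, Quot.mk (Glue F G) (Sum.inl (join X X (Sum.inl i))) =
      Quot.mk _ (Sum.inr (join X X (Sum.inl i))) := fun i => by
    simpa [F, G, Map.fold, Map.assoc] using mk_glue F G (join _ _ (Sum.inl (join _ _ (Sum.inl i))))
  have h2 : ∀ i : Pos X, Quot.mk (Glue F G) (Sum.inl (join X X (Sum.inl i))) =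
      Quot.mk _ (Sum.inr (join X X (Sum.inr i))) := fun i => by
    simpa [F, G, Map.fold, Map.assoc] using mk_glue F G (join _ _ (Sum.inl (join _ _ (Sum.inr i))))
  have h3 : ∀ i : Pos X, Quot.mk (Glue F G) (Sum.inl (join X X (Sum.inr i))) =
      Quot.mk _ (Sum.inr (join X X (Sum.inr i))) := fun i => by
    simpa [F, G, Map.fold, Map.assoc] using mk_glue F G (join _ _ (Sum.inr i))
  refine cofn_comp_fn _ _ _ _ ?_ (fun i => Quot.mk _ (Sum.inl (join X X (Sum.inl i))))
    (fun i => ⟨Sum.inl (join X X (Sum.inl i)), by simp [Map.fold]⟩) ?_ ?_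
  · refine join_cases (join_cases (fun i => ?_) (fun i => ?_)) (fun i => ?_) <;>
      simp [Map.assoc, Map.fold]
  · refine join_cases (fun i => ?_) (fun i => ?_)
    · simp [Map.fold]
    · simp only [Map.fold, Map.elim_toFun, Equiv.symm_apply_apply, Sum.elim_inr, Map.id_toFun]
      exact (h2 i).trans (h3 i).symm
  · refine join_cases (fun i => ?_) (fun i => ?_)
    · simp only [Map.fold, Map.elim_toFun, Equiv.symm_apply_apply, Sum.elim_inl, Map.id_toFun]
      exact h1 i
    · simp only [Map.fold, Map.elim_toFun, Equiv.symm_apply_apply, Sum.elim_inr, Map.id_toFun]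
      exact h2 i

end DotDiagram

/-- Isomorphism classes of dot-diagrams. -/
def DotHom (S : MonoidalSignature.{u, v}) (X Y : List S.Obj) :=
  Quotient (DotDiagram.setoid S X Y)

namespace DotHom

variable {S : MonoidalSignature.{u, v}} {X Y Z X' Y' Z' : List S.Obj}

/-- The class of a dot-diagram. -/
def mk (F : DotDiagram S X Y) : DotHom S X Y := Quotient.mk _ F

/-- Composition of classes. -/
def comp : DotHom S X Y → DotHom S Y Z → DotHom S X Z :=
  Quotient.map₂ DotDiagram.comp fun _ _ h _ _ h' => DotDiagram.comp_congr h h'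

/-- Monoidal product of classes. -/
def tensor : DotHom S X Y → DotHom S X' Y' → DotHom S (X ++ X') (Y ++ Y') :=
  Quotient.map₂ DotDiagram.tensor fun _ _ h _ _ h' => DotDiagram.tensor_congr h h'

/-- The class of `DotDiagram.fn r`. -/
def fn (r : Map X Y) : DotHom S X Y := mk (DotDiagram.fn r)

/-- The class of `DotDiagram.cofn r`. -/
def cofn (r : Map Y X) : DotHom S X Y := mk (DotDiagram.cofn r)

theorem comp_assoc {W : List S.Obj} (f : DotHom S W X) (g : DotHom S X Y) (h : DotHom S Y Z) :
    (f.comp g).comp h = f.comp (g.comp h) := by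
  induction f using Quotient.ind; induction g using Quotient.ind; induction h using Quotient.ind
  exact Quotient.sound (DotDiagram.comp_assoc _ _ _)

theorem tensor_comp (f : DotHom S X Y) (f' : DotHom S X' Y') (g : DotHom S Y Z)
    (g' : DotHom S Y' Z') : (f.tensor f').comp (g.tensor g') = (f.comp g).tensor (f'.comp g') := by
  induction f using Quotient.ind; induction f' using Quotient.ind
  induction g using Quotient.ind; induction g' using Quotient.ind
  exact Quotient.sound (DotDiagram.tensor_comp _ _ _ _)

theorem fn_comp_mk (r : Map X Y) (G : DotDiagram S Y Z) :
    (fn r).comp (mk G) = mk (DotDiagram.pre r G) := Quotient.sound (DotDiagram.fn_comp r G)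

theorem mk_comp_cofn (F : DotDiagram S X Y) (r : Map Z Y) :
    (mk F).comp (cofn r) = mk (DotDiagram.post F r) := Quotient.sound (DotDiagram.comp_cofn F r)

theorem fn_comp_fn (r : Map X Y) (s : Map Y Z) :
    (fn r : DotHom S X Y).comp (fn s) = fn (r.comp s) := fn_comp_mk _ _

theorem cofn_comp_cofn (r : Map Y X) (s : Map Z Y) :
    (cofn r : DotHom S X Y).comp (cofn s) = cofn (s.comp r) := mk_comp_cofn _ _

theorem tensor_fn (r : Map X Y) (s : Map X' Y') :
    (fn r : DotHom S X Y).tensor (fn s) = fn (r.sum s) :=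
  Quotient.sound (DotDiagram.tensor_fn r s)

theorem tensor_cofn (r : Map Y X) (s : Map Y' X') :
    (cofn r : DotHom S X Y).tensor (cofn s) = cofn (r.sum s) :=
  Quotient.sound (DotDiagram.tensor_cofn r s)

theorem fn_eq_cofn {r : Map X Y} {s : Map Y X} (hr : r.comp s = Map.id X) (hs : s.comp r = Map.id Y) :
    (fn r : DotHom S X Y) = cofn s :=
  Quotient.sound (DotDiagram.fn_equiv_cofn r s (fun i => congrArg (fun t => Map.toFun t i) hr)
    (fun i => congrArg (fun t => Map.toFun t i) hs))

theorem fn_id (X : List S.Obj) : (fn (Map.id X) : DotHom S X X) = cofn (Map.id X) :=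
  fn_eq_cofn rfl rfl

theorem id_comp (f : DotHom S X Y) : (fn (Map.id X)).comp f = f := by
  induction f using Quotient.ind
  exact fn_comp_mk _ _

theorem comp_id (f : DotHom S X Y) : f.comp (fn (Map.id Y)) = f := by
  induction f using Quotient.ind
  rw [fn_id]
  exact mk_comp_cofn _ _

theorem swap_nat (F : DotDiagram S X X') (G : DotDiagram S Y Y') :
    (mk (DotDiagram.tensor F G)).comp (fn (Map.swap X' Y')) =
      (fn (Map.swap X Y)).comp (mk (DotDiagram.tensor G F)) := by
  rw [fn_eq_cofn (Map.swap_comp_swap X' Y') (Map.swap_comp_swap Y' X')]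
  exact (mk_comp_cofn _ _).trans
    ((Quotient.sound (DotDiagram.swap_nat F G)).trans (fn_comp_mk _ _).symm)

end DotHom


section Hypergraph

variable {C : Type u} [Category.{v} C] [MonoidalCategory C] [SymmetricCategory C]

/-- A special commutative Frobenius algebra structure on an object. -/
structure SCFA (A : C) extends MonObj A, ComonObj A where
  mul_comm : (β_ A A).hom ≫ mul = mul
  comul_comm : comul ≫ (β_ A A).hom = comul
  frobenius : comul ▷ A ≫ (α_ A A A).hom ≫ A ◁ mul = mul ≫ comul
  special : comul ≫ mul = 𝟙 A

/-- A hypergraph category: a symmetric monoidal category in which every object carries a special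
commutative Frobenius algebra, compatibly with the monoidal product. -/
class HypergraphCategory (C : Type u) [Category.{v} C] [MonoidalCategory C]
    [SymmetricCategory C] where
  scfa : ∀ A : C, SCFA A
  mul_tensor : ∀ A B : C, (scfa (A ⊗ B)).mul =
    tensorμ A B A B ≫ ((scfa A).mul ⊗ₘ (scfa B).mul)
  one_tensor : ∀ A B : C, (scfa (A ⊗ B)).one =
    (λ_ (𝟙_ C)).inv ≫ ((scfa A).one ⊗ₘ (scfa B).one)
  comul_tensor : ∀ A B : C, (scfa (A ⊗ B)).comul =
    ((scfa A).comul ⊗ₘ (scfa B).comul) ≫ tensorμ A A B B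
  counit_tensor : ∀ A B : C, (scfa (A ⊗ B)).counit =
    ((scfa A).counit ⊗ₘ (scfa B).counit) ≫ (λ_ (𝟙_ C)).hom

/-- A strong symmetric monoidal functor between hypergraph categories is a hypergraph functor if
it preserves the Frobenius algebra of every object. -/
class IsHypergraphFunctor {C : Type*} [Category* C] [MonoidalCategory C] [SymmetricCategory C]
    [HypergraphCategory C] {D : Type*} [Category* D] [MonoidalCategory D] [SymmetricCategory D]
    [HypergraphCategory D] (M : C ⥤ D) [M.Braided] : Prop where
  map_mul : ∀ A : C, Functor.LaxMonoidal.μ M A A ≫ M.map (HypergraphCategory.scfa A).mul =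
    (HypergraphCategory.scfa (M.obj A)).mul
  map_one : ∀ A : C, Functor.LaxMonoidal.ε M ≫ M.map (HypergraphCategory.scfa A).one =
    (HypergraphCategory.scfa (M.obj A)).one
  map_comul : ∀ A : C, M.map (HypergraphCategory.scfa A).comul ≫ Functor.OplaxMonoidal.δ M A A =
    (HypergraphCategory.scfa (M.obj A)).comul
  map_counit : ∀ A : C, M.map (HypergraphCategory.scfa A).counit ≫ Functor.OplaxMonoidal.η M =
    (HypergraphCategory.scfa (M.obj A)).counit

end Hypergraph

/-- The objects of the category of dot-diagrams: words in the object symbols. -/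
def DotCat (S : MonoidalSignature.{u, v}) : Type u := List S.Obj

namespace DotCat

variable {S : MonoidalSignature.{u, v}}

/-- Morphisms are isomorphism classes of dot-diagrams. -/
instance : Category (DotCat S) where
  Hom X Y := DotHom S X Y
  id X := DotHom.fn (Map.id X)
  comp f g := DotHom.comp f g
  id_comp f := DotHom.id_comp f
  comp_id f := DotHom.comp_id f
  assoc f g h := DotHom.comp_assoc f g h

/-- The morphism given by a box-free diagram that joins the diagram inputs to the diagram outputs
along `r`. -/
def fn {X Y : DotCat S} (r : Map (α := S.Obj) X Y) : X ⟶ Y := DotHom.fn r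

/-- The morphism given by a box-free diagram that joins the diagram outputs to the diagram inputs
along `r`. -/
def cofn {X Y : DotCat S} (r : Map (α := S.Obj) Y X) : X ⟶ Y := DotHom.cofn r

theorem fn_comp {X Y Z : DotCat S} (r : Map (α := S.Obj) X Y) (s : Map (α := S.Obj) Y Z) :
    fn r ≫ fn s = fn (r.comp s) := DotHom.fn_comp_fn r s

theorem cofn_comp {X Y Z : DotCat S} (r : Map (α := S.Obj) Y X) (s : Map (α := S.Obj) Z Y) :
    cofn r ≫ cofn s = cofn (s.comp r) := DotHom.cofn_comp_cofn r s

theorem fn_id (X : DotCat S) : fn (Map.id (α := S.Obj) X) = 𝟙 X := rfl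

theorem cofn_id (X : DotCat S) : cofn (Map.id (α := S.Obj) X) = 𝟙 X := (DotHom.fn_id X).symm

/-- The isomorphism given by mutually inverse maps of positions. -/
@[simps] def isoOfMap {X Y : DotCat S} (r : Map (α := S.Obj) X Y) (s : Map (α := S.Obj) Y X)
    (hr : r.comp s = Map.id (α := S.Obj) X) (hs : s.comp r = Map.id (α := S.Obj) Y) : X ≅ Y where
  hom := fn r
  inv := fn s
  hom_inv_id := by rw [fn_comp, hr, fn_id]
  inv_hom_id := by rw [fn_comp, hs, fn_id]

instance : MonoidalCategoryStruct (DotCat S) where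
  tensorObj X Y := List.append X Y
  tensorHom f g := DotHom.tensor f g
  whiskerLeft X _ _ f := DotHom.tensor (DotHom.fn (Map.id X)) f
  whiskerRight f Y := DotHom.tensor f (DotHom.fn (Map.id Y))
  tensorUnit := []
  associator X Y Z := isoOfMap _ _ (Map.assoc_comp_assocInv (α := S.Obj) X Y Z)
    (Map.assocInv_comp_assoc (α := S.Obj) X Y Z)
  leftUnitor X := isoOfMap _ _ (Map.left_comp_inr (α := S.Obj) X) (Map.inr_comp_left (α := S.Obj) X)
  rightUnitor X :=
    isoOfMap _ _ (Map.right_comp_inl (α := S.Obj) X) (Map.inl_comp_right (α := S.Obj) X)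

/-- Concatenation of maps of positions, typed for the monoidal product. -/
abbrev sum {X Y X' Y' : DotCat S} (r : Map (α := S.Obj) X Y) (s : Map (α := S.Obj) X' Y') :
    Map (α := S.Obj) (X ⊗ X' : DotCat S) (Y ⊗ Y' : DotCat S) := Map.sum (α := S.Obj) r s

theorem fn_tensor {X Y X' Y' : DotCat S} (r : Map (α := S.Obj) X Y) (s : Map (α := S.Obj) X' Y') :
    fn r ⊗ₘ fn s = fn (sum r s) := DotHom.tensor_fn r s

theorem cofn_tensor {X Y X' Y' : DotCat S} (r : Map (α := S.Obj) Y X) (s : Map (α := S.Obj) Y' X') :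
    cofn r ⊗ₘ cofn s = cofn (sum r s) := DotHom.tensor_cofn r s

theorem whiskerLeft_fn (X : DotCat S) {Y Z : DotCat S} (r : Map (α := S.Obj) Y Z) :
    X ◁ fn r = fn (sum (Map.id (α := S.Obj) X) r) := DotHom.tensor_fn _ r

theorem whiskerRight_fn {Y Z : DotCat S} (r : Map (α := S.Obj) Y Z) (X : DotCat S) :
    fn r ▷ X = fn (sum r (Map.id (α := S.Obj) X)) := DotHom.tensor_fn r _

theorem whiskerLeft_cofn (X : DotCat S) {Y Z : DotCat S} (r : Map (α := S.Obj) Z Y) :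
    X ◁ cofn r = cofn (sum (Map.id (α := S.Obj) X) r) := by
  rw [← cofn_tensor, cofn_id]; rfl

theorem whiskerRight_cofn {Y Z : DotCat S} (r : Map (α := S.Obj) Z Y) (X : DotCat S) :
    cofn r ▷ X = cofn (sum r (Map.id (α := S.Obj) X)) := by
  rw [← cofn_tensor, cofn_id]; rfl

theorem associator_hom (X Y Z : DotCat S) :
    (α_ X Y Z).hom = fn (Map.assoc (α := S.Obj) X Y Z) := rfl

theorem associator_inv (X Y Z : DotCat S) :
    (α_ X Y Z).inv = fn (Map.assocInv (α := S.Obj) X Y Z) := rfl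

theorem leftUnitor_hom (X : DotCat S) : (λ_ X).hom = fn (Map.left (α := S.Obj) X) := rfl

theorem leftUnitor_inv (X : DotCat S) : (λ_ X).inv = fn (Map.inr (α := S.Obj) [] X) := rfl

theorem rightUnitor_hom (X : DotCat S) : (ρ_ X).hom = fn (Map.right (α := S.Obj) X) := rfl

theorem rightUnitor_inv (X : DotCat S) : (ρ_ X).inv = fn (Map.inl (α := S.Obj) X []) := rfl

theorem associator_hom' (X Y Z : DotCat S) :
    (α_ X Y Z).hom = cofn (Map.assocInv (α := S.Obj) X Y Z) :=
  DotHom.fn_eq_cofn (Map.assoc_comp_assocInv _ _ _) (Map.assocInv_comp_assoc _ _ _)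

theorem associator_inv' (X Y Z : DotCat S) :
    (α_ X Y Z).inv = cofn (Map.assoc (α := S.Obj) X Y Z) :=
  DotHom.fn_eq_cofn (Map.assocInv_comp_assoc _ _ _) (Map.assoc_comp_assocInv _ _ _)

theorem leftUnitor_hom' (X : DotCat S) : (λ_ X).hom = cofn (Map.inr (α := S.Obj) [] X) :=
  DotHom.fn_eq_cofn (Map.left_comp_inr _) (Map.inr_comp_left _)

theorem leftUnitor_inv' (X : DotCat S) : (λ_ X).inv = cofn (Map.left (α := S.Obj) X) :=
  DotHom.fn_eq_cofn (Map.inr_comp_left _) (Map.left_comp_inr _)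

theorem rightUnitor_hom' (X : DotCat S) : (ρ_ X).hom = cofn (Map.inl (α := S.Obj) X []) :=
  DotHom.fn_eq_cofn (Map.right_comp_inl _) (Map.inl_comp_right _)

theorem rightUnitor_inv' (X : DotCat S) : (ρ_ X).inv = cofn (Map.right (α := S.Obj) X) :=
  DotHom.fn_eq_cofn (Map.inl_comp_right _) (Map.right_comp_inl _)

instance : MonoidalCategory (DotCat S) := MonoidalCategory.ofTensorHom
  (id_tensorHom_id := fun X Y => by
    exact (fn_tensor (Map.id (α := S.Obj) X) (Map.id (α := S.Obj) Y)).trans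
      (congrArg fn (Map.id_sum_id (α := S.Obj) X Y)))
  (id_tensorHom := fun _ _ _ _ => rfl)
  (tensorHom_id := fun _ _ => rfl)
  (tensorHom_comp_tensorHom := fun f f' g g' => DotHom.tensor_comp f f' g g')
  (associator_naturality := fun {X₁ X₂ X₃ Y₁ Y₂ Y₃} f g h => by
    rw [associator_hom', associator_hom]
    induction f using Quotient.ind; induction g using Quotient.ind; induction h using Quotient.ind
    exact (DotHom.mk_comp_cofn _ _).trans
      ((Quotient.sound (DotDiagram.assoc_nat _ _ _)).trans (DotHom.fn_comp_mk _ _).symm))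
  (leftUnitor_naturality := fun f => by
    rw [leftUnitor_hom', leftUnitor_hom]
    induction f using Quotient.ind
    exact (DotHom.mk_comp_cofn _ _).trans
      ((Quotient.sound (DotDiagram.left_nat _)).trans (DotHom.fn_comp_mk _ _).symm))
  (rightUnitor_naturality := fun f => by
    rw [rightUnitor_hom', rightUnitor_hom]
    induction f using Quotient.ind
    exact (DotHom.mk_comp_cofn _ _).trans
      ((Quotient.sound (DotDiagram.right_nat _)).trans (DotHom.fn_comp_mk _ _).symm))
  (pentagon := fun W X Y Z => by
    simp only [associator_hom, ← fn_id, fn_tensor, fn_comp]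
    exact congrArg fn (Map.pentagon (α := S.Obj) W X Y Z))
  (triangle := fun X Y => by
    simp only [associator_hom, leftUnitor_hom, rightUnitor_hom, ← fn_id, fn_tensor, fn_comp]
    exact congrArg fn (Map.triangle (α := S.Obj) X Y))

/-- The swap maps. -/
instance : BraidedCategory (DotCat S) where
  braiding X Y := isoOfMap _ _ (Map.swap_comp_swap (α := S.Obj) X Y)
    (Map.swap_comp_swap (α := S.Obj) Y X)
  braiding_naturality_right X Y Z f := by
    induction f using Quotient.ind
    exact DotHom.swap_nat _ _
  braiding_naturality_left f Z := by
    induction f using Quotient.ind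
    exact DotHom.swap_nat _ _
  hexagon_forward X Y Z := by
    simp only [isoOfMap_hom, associator_hom, whiskerLeft_fn, whiskerRight_fn, fn_comp]
    exact congrArg fn (Map.hexagon (α := S.Obj) X Y Z)
  hexagon_reverse X Y Z := by
    simp only [isoOfMap_hom, associator_inv, whiskerLeft_fn, whiskerRight_fn, fn_comp]
    exact congrArg fn (Map.hexagon' (α := S.Obj) X Y Z)

theorem braiding_hom (X Y : DotCat S) :
    (β_ X Y).hom = fn (Map.swap (α := S.Obj) X Y) := rfl

theorem braiding_hom' (X Y : DotCat S) :
    (β_ X Y).hom = cofn (Map.swap (α := S.Obj) Y X) :=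
  DotHom.fn_eq_cofn (Map.swap_comp_swap _ _) (Map.swap_comp_swap _ _)

instance : SymmetricCategory (DotCat S) where
  symmetry X Y := by
    rw [braiding_hom, braiding_hom, fn_comp]
    exact congrArg fn (Map.swap_comp_swap (α := S.Obj) X Y)

theorem tensorμ_eq (X Y Z W : DotCat S) :
    tensorμ X Y Z W = fn (Map.shuffle (α := S.Obj) X Y Z W) := by
  simp only [tensorμ, braiding_hom, associator_hom, associator_inv, whiskerLeft_fn,
    whiskerRight_fn, fn_comp]
  exact congrArg fn (Map.shuffle_eq (α := S.Obj) X Y Z W)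

theorem tensorμ_eq' (X Y Z W : DotCat S) :
    tensorμ X Y Z W = cofn (Map.shuffle (α := S.Obj) X Z Y W) :=
  (tensorμ_eq X Y Z W).trans
    (DotHom.fn_eq_cofn (Map.shuffle_shuffle _ _ _ _) (Map.shuffle_shuffle _ _ _ _))

/-- Folding, typed for the monoidal product. -/
abbrev fold (X : DotCat S) : Map (α := S.Obj) (X ⊗ X : DotCat S) X := Map.fold (α := S.Obj) X

/-- The map out of the empty word, typed for the monoidal unit. -/
abbrev empty (X : DotCat S) : Map (α := S.Obj) (𝟙_ (DotCat S)) X := Map.empty (α := S.Obj) X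

/-- The Frobenius algebra on a word: one dot for each position, wired to all copies of that
position among the inputs and outputs. -/
def scfa (X : DotCat S) : SCFA X where
  mul := fn (fold X)
  one := fn (empty X)
  comul := cofn (fold X)
  counit := cofn (empty X)
  one_mul := by
    rw [whiskerRight_fn, leftUnitor_hom, fn_comp]
    exact congrArg fn (Map.one_mul (α := S.Obj) X)
  mul_one := by
    rw [whiskerLeft_fn, rightUnitor_hom, fn_comp]
    exact congrArg fn (Map.mul_one (α := S.Obj) X)
  mul_assoc := by
    rw [whiskerLeft_fn, whiskerRight_fn, associator_hom, fn_comp, fn_comp, fn_comp]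
    exact congrArg fn (Map.mul_assoc (α := S.Obj) X)
  counit_comul := by
    rw [whiskerRight_cofn, leftUnitor_inv', cofn_comp]
    exact congrArg cofn (Map.one_mul (α := S.Obj) X)
  comul_counit := by
    rw [whiskerLeft_cofn, rightUnitor_inv', cofn_comp]
    exact congrArg cofn (Map.mul_one (α := S.Obj) X)
  comul_assoc := by
    rw [whiskerLeft_cofn, whiskerRight_cofn, associator_hom', cofn_comp, cofn_comp, cofn_comp]
    exact congrArg cofn (Map.mul_assoc' (α := S.Obj) X)
  mul_comm := by
    rw [braiding_hom, fn_comp]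
    exact congrArg fn (Map.mul_comm (α := S.Obj) X)
  comul_comm := by
    rw [braiding_hom', cofn_comp]
    exact congrArg cofn (Map.mul_comm (α := S.Obj) X)
  frobenius := by
    rw [whiskerLeft_fn, whiskerRight_cofn, associator_hom, fn_comp]
    exact Quotient.sound (DotDiagram.frobenius (S := S) X)
  special := (Quotient.sound (DotDiagram.special (S := S) X)).trans
    (DotHom.mk_comp_cofn (S := S) (DotDiagram.fn (Map.id X)) (Map.id X))

instance : HypergraphCategory (DotCat S) where
  scfa := scfa
  mul_tensor X Y := by
    change _ = tensorμ X Y X Y ≫ (fn (fold X) ⊗ₘ fn (fold Y))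
    rw [fn_tensor, tensorμ_eq, fn_comp]
    exact congrArg fn (Map.mul_tensor (α := S.Obj) X Y).symm
  one_tensor X Y := by
    change _ = (λ_ (𝟙_ (DotCat S))).inv ≫
      (fn (empty X) ⊗ₘ fn (empty Y))
    rw [fn_tensor, leftUnitor_inv, fn_comp]
    exact congrArg fn (Map.one_tensor (α := S.Obj) X Y).symm
  comul_tensor X Y := by
    change _ = (cofn (fold X) ⊗ₘ cofn (fold Y)) ≫ tensorμ X X Y Y
    rw [cofn_tensor, tensorμ_eq', cofn_comp]
    exact congrArg cofn (Map.mul_tensor (α := S.Obj) X Y).symm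
  counit_tensor X Y := by
    change _ = (cofn (empty X) ⊗ₘ cofn (empty Y)) ≫
      (λ_ (𝟙_ (DotCat S))).hom
    rw [cofn_tensor, leftUnitor_hom', cofn_comp]
    exact congrArg cofn (Map.one_tensor (α := S.Obj) X Y).symm

end DotCat

/-- The objects of the category of matrices over `R`: finite sets. -/
structure MatCat (R : Type u) where
  carrier : Type w
  [fintype : Fintype carrier]
  [decidableEq : DecidableEq carrier]

namespace MatCat

instance (R : Type u) : CoeSort (MatCat.{u, w} R) (Type w) := ⟨carrier⟩

attribute [instance] fintype decidableEq

/-- A morphism is a matrix; the first index is the input, the second index is the output. -/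
@[ext] structure Hom {R : Type u} (X Y : MatCat.{u, w} R) where
  entry : Matrix X Y R

variable {R : Type u} [CommSemiring R]

instance : Category (MatCat.{u, w} R) where
  Hom X Y := Hom X Y
  id X := ⟨1⟩
  comp f g := ⟨f.entry * g.entry⟩
  id_comp f := by simp
  comp_id f := by simp
  assoc f g h := by simp [Matrix.mul_assoc]

@[ext] theorem hom_ext {X Y : MatCat.{u, w} R} {f g : X ⟶ Y}
    (h : ∀ x y, f.entry x y = g.entry x y) : f = g := Hom.ext (Matrix.ext h)

theorem id_entry (X : MatCat.{u, w} R) (x y : X) :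
    Hom.entry (𝟙 X) x y = if x = y then 1 else 0 := rfl

theorem comp_entry {X Y Z : MatCat.{u, w} R} (f : X ⟶ Y) (g : Y ⟶ Z) (x : X) (z : Z) :
    (f ≫ g).entry x z = ∑ y : Y, f.entry x y * g.entry y z := rfl

/-- The matrix of a function. -/
def fn {X Y : MatCat.{u, w} R} (r : X → Y) : X ⟶ Y := ⟨fun x y => if r x = y then 1 else 0⟩

/-- The transpose of the matrix of a function. -/
def cofn {X Y : MatCat.{u, w} R} (r : Y → X) : X ⟶ Y := ⟨fun x y => if x = r y then 1 else 0⟩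

theorem fn_entry {X Y : MatCat.{u, w} R} (r : X → Y) (x : X) (y : Y) :
    (fn r : X ⟶ Y).entry x y = if r x = y then 1 else 0 := rfl

theorem cofn_entry {X Y : MatCat.{u, w} R} (r : Y → X) (x : X) (y : Y) :
    (cofn r : X ⟶ Y).entry x y = if x = r y then 1 else 0 := rfl

theorem fn_comp_entry {X Y Z : MatCat.{u, w} R} (r : X → Y) (f : Y ⟶ Z) (x : X) (z : Z) :
    (fn r ≫ f).entry x z = f.entry (r x) z := by
  simp [comp_entry, fn_entry]

theorem comp_cofn_entry {X Y Z : MatCat.{u, w} R} (f : X ⟶ Y) (r : Z → Y) (x : X) (z : Z) :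
    (f ≫ cofn r).entry x z = f.entry x (r z) := by
  simp [comp_entry, cofn_entry]

theorem fn_comp {X Y Z : MatCat.{u, w} R} (r : X → Y) (s : Y → Z) :
    (fn r : X ⟶ Y) ≫ fn s = fn (fun x => s (r x)) := by
  ext x z; rw [fn_comp_entry]; rfl

theorem cofn_comp {X Y Z : MatCat.{u, w} R} (r : Y → X) (s : Z → Y) :
    (cofn r : X ⟶ Y) ≫ cofn s = cofn (fun x => r (s x)) := by
  ext x z; rw [comp_cofn_entry]; rfl

theorem fn_eq_cofn {X Y : MatCat.{u, w} R} (e : X ≃ Y) : (fn e : X ⟶ Y) = cofn e.symm := by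
  ext x y
  simp only [fn_entry, cofn_entry, Equiv.eq_symm_apply]

/-- The isomorphism given by a bijection. -/
@[simps] def isoOfEquiv {X Y : MatCat.{u, w} R} (e : X ≃ Y) : X ≅ Y where
  hom := fn e
  inv := fn e.symm
  hom_inv_id := by rw [fn_comp]; simp only [Equiv.symm_apply_apply]; rfl
  inv_hom_id := by rw [fn_comp]; simp only [Equiv.apply_symm_apply]; rfl

/-- The monoidal product of objects is the product of sets, that of morphisms is the Kronecker
product of matrices. -/
instance : MonoidalCategoryStruct (MatCat.{u, w} R) where
  tensorObj X Y := ⟨X × Y⟩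
  tensorHom f g := ⟨fun x y => f.entry x.1 y.1 * g.entry x.2 y.2⟩
  whiskerLeft X _ _ f := ⟨fun x y => Hom.entry (𝟙 X) x.1 y.1 * f.entry x.2 y.2⟩
  whiskerRight f Y := ⟨fun x y => f.entry x.1 y.1 * Hom.entry (𝟙 Y) x.2 y.2⟩
  tensorUnit := ⟨PUnit⟩
  associator X Y Z := isoOfEquiv (X := ⟨(X × Y) × Z⟩) (Y := ⟨X × (Y × Z)⟩) (Equiv.prodAssoc X Y Z)
  leftUnitor X := isoOfEquiv (X := ⟨PUnit × X⟩) (Equiv.punitProd X)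
  rightUnitor X := isoOfEquiv (X := ⟨X × PUnit⟩) (Equiv.prodPUnit X)

theorem tensorHom_entry {X Y X' Y' : MatCat.{u, w} R} (f : X ⟶ Y) (g : X' ⟶ Y')
    (x : X × X') (y : Y × Y') :
    (f ⊗ₘ g).entry x y = f.entry x.1 y.1 * g.entry x.2 y.2 := rfl

theorem whiskerLeft_def (X : MatCat.{u, w} R) {Y Z : MatCat.{u, w} R} (f : Y ⟶ Z) :
    X ◁ f = 𝟙 X ⊗ₘ f := rfl

theorem whiskerRight_def {Y Z : MatCat.{u, w} R} (f : Y ⟶ Z) (X : MatCat.{u, w} R) :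
    f ▷ X = f ⊗ₘ 𝟙 X := rfl

theorem ite_mul_ite {α β : Type*} [DecidableEq α] [DecidableEq β] (a a' : α) (b b' : β) :
    (if a = a' then (1 : R) else 0) * (if b = b' then 1 else 0) =
      if (a, b) = (a', b') then 1 else 0 := by
  by_cases h : a = a' <;> by_cases h' : b = b' <;> simp [h, h']

theorem ite_frobenius {α : Type*} [Fintype α] [DecidableEq α] (x x' y y' : α) :
    (if (x, (x, x')) = (y, (y', y')) then (1 : R) else 0) =
      ∑ z, (if (x, x') = (z, z) then (1 : R) else 0) * (if (z, z) = (y, y') then 1 else 0) := by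
  rw [Finset.sum_eq_single x (fun z _ h => by simp [h.symm]) (by simp)]
  by_cases h : x = x'
  · subst h; simp
  · have : ¬(x = y' ∧ x' = y') := fun h' => h (h'.1.trans h'.2.symm)
    simp [this, Ne.symm h]

theorem ite_diag {α : Type*} [DecidableEq α] (x y : α) :
    (if (x, x) = (y, y) then (1 : R) else 0) = if x = y then 1 else 0 := by
  simp

theorem fn_tensor {X Y X' Y' : MatCat.{u, w} R} (r : X → Y) (s : X' → Y') :
    (fn r : X ⟶ Y) ⊗ₘ (fn s : X' ⟶ Y') =
      fn (X := X ⊗ X') (Y := Y ⊗ Y') (fun x : X × X' => (r x.1, s x.2)) := by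
  ext ⟨x, x'⟩ ⟨y, y'⟩
  exact ite_mul_ite _ _ _ _

theorem cofn_tensor {X Y X' Y' : MatCat.{u, w} R} (r : Y → X) (s : Y' → X') :
    (cofn r : X ⟶ Y) ⊗ₘ (cofn s : X' ⟶ Y') =
      cofn (X := X ⊗ X') (Y := Y ⊗ Y') (fun x : Y × Y' => (r x.1, s x.2)) := by
  ext ⟨x, x'⟩ ⟨y, y'⟩
  exact ite_mul_ite _ _ _ _

theorem fn_id (X : MatCat.{u, w} R) : fn (fun x : X => x) = 𝟙 X := rfl

theorem cofn_id (X : MatCat.{u, w} R) : cofn (fun x : X => x) = 𝟙 X := rfl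

theorem associator_hom (X Y Z : MatCat.{u, w} R) : (α_ X Y Z).hom =
    fn (X := (X ⊗ Y) ⊗ Z) (Y := X ⊗ (Y ⊗ Z)) (Equiv.prodAssoc X Y Z) := rfl

theorem associator_inv (X Y Z : MatCat.{u, w} R) : (α_ X Y Z).inv =
    fn (Y := (X ⊗ Y) ⊗ Z) (X := X ⊗ (Y ⊗ Z)) (Equiv.prodAssoc X Y Z).symm := rfl

theorem leftUnitor_hom (X : MatCat.{u, w} R) : (λ_ X).hom =
    fn (X := 𝟙_ _ ⊗ X) (Equiv.punitProd X) := rfl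

theorem leftUnitor_inv (X : MatCat.{u, w} R) : (λ_ X).inv =
    fn (Y := 𝟙_ _ ⊗ X) (Equiv.punitProd X).symm := rfl

theorem rightUnitor_hom (X : MatCat.{u, w} R) : (ρ_ X).hom =
    fn (X := X ⊗ 𝟙_ _) (Equiv.prodPUnit X) := rfl

theorem rightUnitor_inv (X : MatCat.{u, w} R) : (ρ_ X).inv =
    fn (Y := X ⊗ 𝟙_ _) (Equiv.prodPUnit X).symm := rfl

theorem associator_hom' (X Y Z : MatCat.{u, w} R) : (α_ X Y Z).hom =
    cofn (X := (X ⊗ Y) ⊗ Z) (Y := X ⊗ (Y ⊗ Z)) (Equiv.prodAssoc X Y Z).symm := fn_eq_cofn _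

theorem associator_inv' (X Y Z : MatCat.{u, w} R) : (α_ X Y Z).inv =
    cofn (Y := (X ⊗ Y) ⊗ Z) (X := X ⊗ (Y ⊗ Z)) (Equiv.prodAssoc X Y Z) := fn_eq_cofn _

theorem leftUnitor_hom' (X : MatCat.{u, w} R) : (λ_ X).hom =
    cofn (X := 𝟙_ _ ⊗ X) (Equiv.punitProd X).symm := fn_eq_cofn _

theorem leftUnitor_inv' (X : MatCat.{u, w} R) : (λ_ X).inv =
    cofn (Y := 𝟙_ _ ⊗ X) (Equiv.punitProd X) := fn_eq_cofn _

theorem rightUnitor_hom' (X : MatCat.{u, w} R) : (ρ_ X).hom =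
    cofn (X := X ⊗ 𝟙_ _) (Equiv.prodPUnit X).symm := fn_eq_cofn _

theorem rightUnitor_inv' (X : MatCat.{u, w} R) : (ρ_ X).inv =
    cofn (Y := X ⊗ 𝟙_ _) (Equiv.prodPUnit X) := fn_eq_cofn _

theorem whiskerLeft_fn (X : MatCat.{u, w} R) {Y Z : MatCat.{u, w} R} (r : Y → Z) :
    X ◁ (fn r : Y ⟶ Z) = fn (X := X ⊗ Y) (Y := X ⊗ Z) (fun x : X × Y => (x.1, r x.2)) :=
  fn_tensor (fun x : X => x) r

theorem whiskerRight_fn {Y Z : MatCat.{u, w} R} (r : Y → Z) (X : MatCat.{u, w} R) :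
    (fn r : Y ⟶ Z) ▷ X = fn (X := Y ⊗ X) (Y := Z ⊗ X) (fun x : Y × X => (r x.1, x.2)) :=
  fn_tensor r (fun x : X => x)

theorem whiskerLeft_cofn (X : MatCat.{u, w} R) {Y Z : MatCat.{u, w} R} (r : Z → Y) :
    X ◁ (cofn r : Y ⟶ Z) = cofn (X := X ⊗ Y) (Y := X ⊗ Z) (fun x : X × Z => (x.1, r x.2)) :=
  cofn_tensor (fun x : X => x) r

theorem whiskerRight_cofn {Y Z : MatCat.{u, w} R} (r : Z → Y) (X : MatCat.{u, w} R) :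
    (cofn r : Y ⟶ Z) ▷ X = cofn (X := Y ⊗ X) (Y := Z ⊗ X) (fun x : Z × X => (r x.1, x.2)) :=
  cofn_tensor r (fun x : X => x)

instance : MonoidalCategory (MatCat.{u, w} R) := MonoidalCategory.ofTensorHom
  (id_tensorHom_id := fun X Y => fn_tensor (fun x : X => x) (fun y : Y => y))
  (id_tensorHom := fun _ _ _ _ => rfl)
  (tensorHom_id := fun _ _ => rfl)
  (tensorHom_comp_tensorHom := fun {X₁ Y₁ Z₁ X₂ Y₂ Z₂} f f' g g' => by
    ext ⟨x, x'⟩ ⟨z, z'⟩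
    simp only [tensorHom_entry, comp_entry, Finset.sum_mul_sum]
    refine (Fintype.sum_prod_type _).trans ?_
    refine Finset.sum_congr rfl fun y _ => Finset.sum_congr rfl fun y' _ => ?_
    exact mul_mul_mul_comm _ _ _ _)
  (associator_naturality := fun f g h => by
    rw [associator_hom', associator_hom]
    ext ⟨⟨x, y⟩, z⟩ ⟨x', y', z'⟩
    rw [comp_cofn_entry, fn_comp_entry]
    exact mul_assoc _ _ _)
  (leftUnitor_naturality := fun f => by
    rw [leftUnitor_hom', leftUnitor_hom]
    ext ⟨_, x⟩ y
    rw [comp_cofn_entry, fn_comp_entry]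
    refine Eq.trans (congrArg (· * _) (Matrix.one_apply_eq PUnit.unit)) (one_mul _))
  (rightUnitor_naturality := fun f => by
    rw [rightUnitor_hom', rightUnitor_hom]
    ext ⟨x, _⟩ y
    rw [comp_cofn_entry, fn_comp_entry]
    refine Eq.trans (congrArg (_ * ·) (Matrix.one_apply_eq PUnit.unit)) (mul_one _))
  (pentagon := fun W X Y Z => by
    simp only [associator_hom, ← fn_id, fn_tensor, fn_comp]; rfl)
  (triangle := fun X Y => by
    simp only [associator_hom, leftUnitor_hom, rightUnitor_hom, ← fn_id, fn_tensor, fn_comp]; rfl)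

instance : BraidedCategory (MatCat.{u, w} R) where
  braiding X Y := isoOfEquiv (X := X ⊗ Y) (Y := Y ⊗ X) (Equiv.prodComm X Y)
  braiding_naturality_right X Y Z f := by
    simp only [isoOfEquiv_hom]
    rw [fn_eq_cofn]
    ext ⟨x, y⟩ ⟨z, x'⟩
    rw [comp_cofn_entry, fn_comp_entry]
    exact mul_comm _ _
  braiding_naturality_left {X Y} f Z := by
    simp only [isoOfEquiv_hom]
    rw [fn_eq_cofn]
    ext ⟨x, y⟩ ⟨z, x'⟩
    rw [comp_cofn_entry, fn_comp_entry]
    exact mul_comm _ _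
  hexagon_forward X Y Z := by
    simp only [isoOfEquiv_hom, associator_hom, whiskerLeft_fn, whiskerRight_fn, fn_comp]; rfl
  hexagon_reverse X Y Z := by
    simp only [isoOfEquiv_hom, associator_inv, whiskerLeft_fn, whiskerRight_fn, fn_comp]; rfl

theorem braiding_hom (X Y : MatCat.{u, w} R) : (β_ X Y).hom =
    fn (X := X ⊗ Y) (Y := Y ⊗ X) (Equiv.prodComm X Y) := rfl

theorem braiding_hom' (X Y : MatCat.{u, w} R) : (β_ X Y).hom =
    cofn (X := X ⊗ Y) (Y := Y ⊗ X) (Equiv.prodComm Y X) := fn_eq_cofn _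

instance : SymmetricCategory (MatCat.{u, w} R) where
  symmetry X Y := by
    rw [braiding_hom, braiding_hom, fn_comp]; rfl

theorem tensorμ_eq (X Y Z W : MatCat.{u, w} R) : tensorμ X Y Z W =
    fn (X := (X ⊗ Y) ⊗ (Z ⊗ W)) (Y := (X ⊗ Z) ⊗ (Y ⊗ W)) (Equiv.prodProdProdComm X Y Z W) := by
  simp only [tensorμ, braiding_hom, associator_hom, associator_inv, whiskerLeft_fn,
    whiskerRight_fn, fn_comp]
  rfl

theorem tensorμ_eq' (X Y Z W : MatCat.{u, w} R) : tensorμ X Y Z W =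
    cofn (X := (X ⊗ Y) ⊗ (Z ⊗ W)) (Y := (X ⊗ Z) ⊗ (Y ⊗ W)) (Equiv.prodProdProdComm X Z Y W) :=
  (tensorμ_eq X Y Z W).trans (fn_eq_cofn _)

/-- The diagonal. -/
abbrev diag (X : MatCat.{u, w} R) : X → (X ⊗ X : MatCat.{u, w} R) := fun x => (x, x)

/-- The constant map to the one-element set. -/
abbrev point (X : MatCat.{u, w} R) : X → (𝟙_ (MatCat.{u, w} R)) := fun _ => PUnit.unit

/-- The Frobenius algebra of generalised Kronecker deltas: the entry of the multiplication at
`(i, j)` and `k` is `1` if `(i, j) = (k, k)` and `0` otherwise, that of the comultiplication at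
`i` and `(j, k)` is `1` if `(i, i) = (j, k)` and `0` otherwise, and all entries of the unit and of
the counit are `1`. -/
def scfa (X : MatCat.{u, w} R) : SCFA X where
  mul := cofn (diag X)
  one := cofn (point X)
  comul := fn (diag X)
  counit := fn (point X)
  one_mul := by rw [whiskerRight_cofn, leftUnitor_hom', cofn_comp]; rfl
  mul_one := by rw [whiskerLeft_cofn, rightUnitor_hom', cofn_comp]; rfl
  mul_assoc := by
    rw [whiskerLeft_cofn, whiskerRight_cofn, associator_hom', cofn_comp, cofn_comp, cofn_comp]
    rfl
  counit_comul := by rw [whiskerRight_fn, leftUnitor_inv, fn_comp]; rfl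
  comul_counit := by rw [whiskerLeft_fn, rightUnitor_inv, fn_comp]; rfl
  comul_assoc := by
    rw [whiskerLeft_fn, whiskerRight_fn, associator_hom, fn_comp, fn_comp, fn_comp]; rfl
  mul_comm := by rw [braiding_hom', cofn_comp]; rfl
  comul_comm := by rw [braiding_hom, fn_comp]; rfl
  frobenius := by
    rw [whiskerLeft_cofn, whiskerRight_fn]
    ext ⟨x, x'⟩ ⟨y, y'⟩
    rw [fn_comp_entry, associator_hom, fn_comp_entry, cofn_entry, comp_entry]
    exact ite_frobenius x x' y y'
  special := by
    ext x y
    rw [fn_comp_entry, cofn_entry, id_entry]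
    exact ite_diag x y

instance : HypergraphCategory (MatCat.{u, w} R) where
  scfa := scfa
  mul_tensor X Y := by
    change _ = tensorμ X Y X Y ≫ (cofn (diag X) ⊗ₘ cofn (diag Y))
    rw [cofn_tensor, tensorμ_eq', cofn_comp]; rfl
  one_tensor X Y := by
    change _ = (λ_ _).inv ≫ (cofn (point X) ⊗ₘ cofn (point Y))
    rw [cofn_tensor, leftUnitor_inv', cofn_comp]; rfl
  comul_tensor X Y := by
    change _ = (fn (diag X) ⊗ₘ fn (diag Y)) ≫ tensorμ X X Y Y
    rw [fn_tensor, tensorμ_eq, fn_comp]; rfl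
  counit_tensor X Y := by
    change _ = (fn (point X) ⊗ₘ fn (point Y)) ≫ (λ_ _).hom
    rw [fn_tensor, leftUnitor_hom, fn_comp]; rfl

end MatCat

/-- A word as an object. -/
abbrev DotCat.word {S : MonoidalSignature.{u, v}} (X : List S.Obj) : DotCat S := X

/-- The class of a closed dot-diagram, as a morphism from the monoidal unit to itself. -/
def DotDiagram.toScalar {S : MonoidalSignature.{u, v}} (F : DotDiagram S [] []) :
    𝟙_ (DotCat S) ⟶ 𝟙_ (DotCat S) :=
  DotHom.mk F

/-- The morphism of dot-diagrams given by a morphism symbol. -/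
def DotCat.box {S : MonoidalSignature.{u, v}} (f : S.Mor) :
    DotCat.word (S.dom f) ⟶ DotCat.word (S.cod f) :=
  DotHom.mk (DotDiagram.box S f)

namespace Contraction

open Functor.LaxMonoidal Functor.OplaxMonoidal

variable {S : MonoidalSignature.{u, v}} {R : Type w} [CommSemiring R]
  (M : DotCat S ⥤ MatCat.{w, z} R)

/-- The value of a functor at a one-letter word. -/
abbrev letterObj (A : S.Obj) : MatCat.{w, z} R := M.obj (DotCat.word [A])

/-- The monoidal product of the values of a functor at the letters of a word. -/
def wordObj : List S.Obj → MatCat.{w, z} R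
  | [] => 𝟙_ _
  | A :: X => letterObj M A ⊗ wordObj X

/-- A family of indices, one for each letter of a word, as an index of the monoidal product. -/
def tuple : (X : List S.Obj) → ((i : Pos X) → letterObj M (letter X i)) → wordObj M X
  | [], _ => PUnit.unit
  | _ :: X, x => (x (0 : Fin (X.length + 1)), tuple X fun i => x (Fin.succ i))

/-- Transport of indices along an equality of letters. -/
def castIndex {A B : S.Obj} (h : A = B) (x : letterObj M A) : letterObj M B := h ▸ x

/-- The set of indexing functions of a dot-diagram. -/
abbrev Idx {X Y : List S.Obj} (F : DotDiagram S X Y) := (d : F.Dot) → letterObj M (F.dotLabel d)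

variable [M.Monoidal]

/-- The canonical isomorphism from the value at a word to the product of the values at the
letters. -/
def split : (X : List S.Obj) → (M.obj (DotCat.word X) ⟶ wordObj M X)
  | [] => η M
  | A :: X => δ M (DotCat.word [A]) (DotCat.word X) ≫ letterObj M A ◁ split X

/-- The inverse of `split`. -/
def unsplit : (X : List S.Obj) → (wordObj M X ⟶ M.obj (DotCat.word X))
  | [] => ε M
  | A :: X => letterObj M A ◁ unsplit X ≫ μ M (DotCat.word [A]) (DotCat.word X)

theorem split_unsplit_step {P Q : DotCat S} {W : MatCat.{w, z} R} {s : M.obj Q ⟶ W}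
    {t : W ⟶ M.obj Q} (h : s ≫ t = 𝟙 _) :
    (δ M P Q ≫ M.obj P ◁ s) ≫ M.obj P ◁ t ≫ μ M P Q = 𝟙 _ := by
  rw [Category.assoc, ← whiskerLeft_comp_assoc, h]
  simp

theorem unsplit_split_step {P Q : DotCat S} {W : MatCat.{w, z} R} {s : M.obj Q ⟶ W}
    {t : W ⟶ M.obj Q} (h : t ≫ s = 𝟙 _) :
    (M.obj P ◁ t ≫ μ M P Q) ≫ δ M P Q ≫ M.obj P ◁ s = 𝟙 _ := by
  rw [Category.assoc, Functor.Monoidal.μ_δ_assoc, ← whiskerLeft_comp, h]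
  simp

theorem split_unsplit : ∀ X : List S.Obj, split M X ≫ unsplit M X = 𝟙 (M.obj (DotCat.word X))
  | [] => Functor.Monoidal.η_ε M
  | _ :: X => split_unsplit_step M (split_unsplit X)

theorem unsplit_split : ∀ X : List S.Obj, unsplit M X ≫ split M X = 𝟙 (wordObj M X)
  | [] => Functor.Monoidal.ε_η M
  | _ :: X => unsplit_split_step M (unsplit_split X)

/-- The entries of the value of a functor at a morphism symbol `f`, the lower indices running over
the inputs and the upper indices over the outputs of `f`. -/
def boxEntry (f : S.Mor) (x : (i : Pos (S.dom f)) → letterObj M (letter (S.dom f) i))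
    (y : (j : Pos (S.cod f)) → letterObj M (letter (S.cod f) j)) : R :=
  MatCat.Hom.entry (unsplit M (S.dom f) ≫ M.map (DotCat.box f) ≫ split M (S.cod f))
    (tuple M (S.dom f) x) (tuple M (S.cod f) y)

/-- The value of a functor at a morphism from the monoidal unit to itself, as an element of `R`. -/
def scalar (f : 𝟙_ (DotCat S) ⟶ 𝟙_ (DotCat S)) : R :=
  MatCat.Hom.entry (ε M ≫ M.map f ≫ η M) PUnit.unit PUnit.unit

end Contraction

/-! List the dots of `F` in some order and let `Z` be the word of their labels. An indexing function
is then the same as an index of `wordObj M Z`, the product of the sets attached to the letters of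
`Z`. Up to isomorphism, `F` is a composite of three morphisms: the unit `[] ⟶ Z`, which creates the
dots; a layer `Z ⟶ Z`, in which every dot is both an input and an output and the boxes hang on the
dots; and the counit `Z ⟶ []`. The functor sends unit and counit to all-ones vectors, so `M(F)` is
the sum of all entries of the matrix of the layer. That matrix is diagonal, and its entry at `x` is
the product of the box entries at the components of `x` selected by the wiring (`mat_layer`,
`scalar_closed`). This is the contraction formula.

The diagonal form comes from adding one box at a time. A layer with one more box is obtained by
copying the dots that feed the box, applying the box in parallel with the old layer, and merging the
box outputs back into their dots. Copying and merging are box-free diagrams along maps of positions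
`r`. The central point is that `M` sends these to the matrix of the restriction of indices `pull M
r`, or to its transpose, because restriction is contravariant (`PreservesWiring.of_map`). Composing
with such a matrix only substitutes indices, so the new box contributes one scalar factor
(`mat_layer_option`). The layer without boxes is the identity, whence the Kronecker delta.

Every map of positions is built from identities, swaps, folds and empty maps on single letters by
composition and concatenation. On single letters the hypotheses on `M` give the claim: braidedness
for swaps, preservation of the Frobenius algebras for folds and empty maps. Passing from letters to
words requires the coherence isomorphisms of `M` to be compatible with concatenation (`mu_split`,
`mat_tensor`). -/

namespace Contraction

open Functor.LaxMonoidal Functor.OplaxMonoidal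

/-! ### Indices of words and their restriction along maps of positions -/

section Lookup

variable {S : MonoidalSignature.{u, v}} {R : Type w} [CommSemiring R]
  (M : DotCat S ⥤ MatCat.{w, z} R)

/-- An index at an unspecified letter. -/
abbrev AnyIndex := Σ A : S.Obj, letterObj M A

/-- Transports along equalities of labels disappear once an index is bundled with its letter. This
is why components of indices are compared in `AnyIndex`. -/
theorem mk_castIndex {A B : S.Obj} (h : A = B) (x : letterObj M A) :
    (⟨B, castIndex M h x⟩ : AnyIndex M) = ⟨A, x⟩ := by
  subst h; rfl

/-- The component of an index of a word at a position. -/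
def look : (X : List S.Obj) → wordObj M X → Pos X → AnyIndex M
  | [], _ => fun i => i.elim0
  | A :: X, x => Fin.cons (α := fun _ => AnyIndex M) ⟨A, x.1⟩ (look X x.2)

theorem look_fst : ∀ (X : List S.Obj) (x : wordObj M X) (i : Pos X),
    (look M X x i).1 = letter X i
  | [], _, i => i.elim0
  | A :: X, x, i => by
    refine Fin.cases (motive := fun i => (look M (A :: X) x i).1 = letter (A :: X) i) rfl
      (fun i => ?_) i
    exact look_fst X x.2 i

/-- Extensionality for indices: equalities in `wordObj` may be checked one position at a time,
without unfolding the nested product. -/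
theorem look_injective : ∀ X : List S.Obj, Function.Injective (look M X)
  | [], x, y, _ => rfl
  | A :: X, (a, x), (b, y), h => by
    have h0 : (⟨A, a⟩ : AnyIndex M) = ⟨A, b⟩ := congrFun h (0 : Fin (X.length + 1))
    have h1 : x = y := look_injective X (funext fun i => congrFun h (Fin.succ i))
    rw [h1, eq_of_heq (Sigma.mk.inj h0).2]

theorem look_tuple : ∀ (X : List S.Obj) (x : (i : Pos X) → letterObj M (letter X i)) (i : Pos X),
    look M X (tuple M X x) i = ⟨letter X i, x i⟩
  | [], _, i => i.elim0
  | A :: X, x, i => by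
    refine Fin.cases (motive := fun i => look M (A :: X) (tuple M (A :: X) x) i =
      ⟨letter (A :: X) i, x i⟩) rfl (fun i => ?_) i
    exact look_tuple X (fun i => x (Fin.succ i)) i

/-- The index of a word with given components. -/
def ofLook (X : List S.Obj) (g : Pos X → AnyIndex M) (h : ∀ i, (g i).1 = letter X i) :
    wordObj M X :=
  tuple M X fun i => castIndex M (h i) (g i).2

theorem look_ofLook (X : List S.Obj) (g : Pos X → AnyIndex M) (h : ∀ i, (g i).1 = letter X i)
    (i : Pos X) : look M X (ofLook M X g h) i = g i := by
  rw [ofLook, look_tuple, mk_castIndex]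

/-- Restriction of indices along a map of positions. -/
def pull {X Y : List S.Obj} (r : Map X Y) (y : wordObj M Y) : wordObj M X :=
  ofLook M X (fun i => look M Y y (r i)) fun i => (look_fst M Y y (r i)).trans (r.letter_toFun i)

@[simp] theorem look_pull {X Y : List S.Obj} (r : Map X Y) (y : wordObj M Y) (i : Pos X) :
    look M X (pull M r y) i = look M Y y (r i) :=
  look_ofLook M X _ _ i

/-- Characterises a restriction by its components; functoriality and the explicit forms on single
letters all go through it. -/
theorem eq_pull {X Y : List S.Obj} {r : Map X Y} {x : wordObj M X} {y : wordObj M Y}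
    (h : ∀ i, look M X x i = look M Y y (r i)) : x = pull M r y :=
  look_injective M X (funext fun i => (h i).trans (look_pull M r y i).symm)

theorem pull_id {X : List S.Obj} (x : wordObj M X) : pull M (Map.id X) x = x :=
  (eq_pull M fun _ => rfl).symm

theorem pull_comp {X Y Z : List S.Obj} (r : Map X Y) (s : Map Y Z) (x : wordObj M Z) :
    pull M (r.comp s) x = pull M r (pull M s x) :=
  (eq_pull M fun i => by simp).symm

/-- Concatenation of indices. -/
def append : (X Y : List S.Obj) → wordObj M X → wordObj M Y → wordObj M (X ++ Y)
  | [], _, _, y => y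
  | _ :: X, Y, x, y => (x.1, append X Y x.2 y)

/-- `append` recurses on the left word, while `join` computes positions arithmetically; this
reconciles the two on the right factor. -/
theorem join_cons_inr (A : S.Obj) (X Y : List S.Obj) (i : Pos Y) :
    join (A :: X) Y (Sum.inr i) = Fin.succ (join X Y (Sum.inr i)) := by
  apply Fin.ext
  simp [join]
  omega

theorem join_nil_inr (Y : List S.Obj) (i : Pos Y) : join [] Y (Sum.inr i) = i := by
  apply Fin.ext
  simp [join]

@[simp] theorem look_append_inl : ∀ (X Y : List S.Obj) (x : wordObj M X) (y : wordObj M Y)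
    (i : Pos X), look M (X ++ Y) (append M X Y x y) (join X Y (Sum.inl i)) = look M X x i
  | [], _, _, _, i => i.elim0
  | A :: X, Y, (a, x), y, i => by
    refine Fin.cases (motive := fun i => look M (A :: (X ++ Y)) (a, append M X Y x y)
      (join (A :: X) Y (Sum.inl i)) = look M (A :: X) (a, x) i) ?_ (fun i => ?_) i
    · rfl
    · exact look_append_inl X Y x y i

@[simp] theorem look_append_inr : ∀ (X Y : List S.Obj) (x : wordObj M X) (y : wordObj M Y)
    (i : Pos Y), look M (X ++ Y) (append M X Y x y) (join X Y (Sum.inr i)) = look M Y y i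
  | [], Y, _, y, i => congrArg (look M Y y) (join_nil_inr Y i)
  | A :: X, Y, (a, x), y, i =>
    (congrArg (look M (A :: (X ++ Y)) (a, append M X Y x y)) (join_cons_inr A X Y i)).trans
      (look_append_inr X Y x y i)

theorem eq_append {X Y : List S.Obj} {t : wordObj M (X ++ Y)} {x : wordObj M X} {y : wordObj M Y}
    (hx : ∀ i, look M (X ++ Y) t (join X Y (Sum.inl i)) = look M X x i)
    (hy : ∀ i, look M (X ++ Y) t (join X Y (Sum.inr i)) = look M Y y i) :
    t = append M X Y x y :=
  look_injective M _ (funext (join_cases (fun i => by simp [hx]) (fun i => by simp [hy])))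

/-- Indices of a concatenation are pairs of indices. -/
def appendEquiv (X Y : List S.Obj) : (wordObj M X ⊗ wordObj M Y : MatCat.{w, z} R) ≃
    wordObj M (X ++ Y) where
  toFun p := append M X Y p.1 p.2
  invFun t := (pull M (Map.inl X Y) t, pull M (Map.inr X Y) t)
  left_inv p := Prod.ext (eq_pull M fun i => by simp).symm (eq_pull M fun i => by simp).symm
  right_inv t := (eq_append M (fun i => by simp) (fun i => by simp)).symm

theorem pull_elim {X Y Z : List S.Obj} (r : Map X Z) (s : Map Y Z) (x : wordObj M Z) :
    pull M (r.elim s) x = append M X Y (pull M r x) (pull M s x) :=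
  eq_append M (fun i => by simp) (fun i => by simp)

theorem pull_sum {X Y X' Y' : List S.Obj} (r : Map X Y) (s : Map X' Y') (x : wordObj M Y)
    (y : wordObj M Y') :
    pull M (r.sum s) (append M Y Y' x y) = append M X X' (pull M r x) (pull M s y) :=
  eq_append M (fun i => by simp) (fun i => by simp)

/-! ### Structure isomorphisms between words that are identities -/

/-- `[] ++ X` reduces to `X`, and the unitor is the box-free diagram along a map that keeps every
position number, so it is an identity. -/
theorem map_leftUnitor_word (X : List S.Obj) :
    M.map (λ_ (DotCat.word X)).hom = 𝟙 (M.obj (DotCat.word X)) := by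
  refine (congrArg M.map ?_).trans (M.map_id _)
  refine congrArg DotCat.fn ?_
  ext i; congr 1; revert i
  refine join_cases (X := []) (fun i => i.elim0) (fun i => ?_)
  exact (by simp [Map.left] : (Map.left X) (join [] X (Sum.inr i)) = i).trans
    (join_nil_inr X i).symm

theorem assoc_val {α : Type u} (X Y Z : List α) (i : Pos ((X ++ Y) ++ Z)) :
    (Map.assoc X Y Z i : ℕ) = i := by
  revert i
  refine join_cases (join_cases (fun i => ?_) (fun i => ?_)) (fun i => ?_)
  all_goals simp [Map.assoc]
  all_goals simp [join]
  all_goals omega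

/-- With a single letter in front, both bracketings reduce to `A :: (X ++ Y)`, so that the
comparison with the identity is well typed. Reassociation does not change position numbers. -/
theorem map_associator_word (A : S.Obj) (X Y : List S.Obj) :
    M.map (α_ (DotCat.word [A]) (DotCat.word X) (DotCat.word Y)).hom =
      𝟙 (M.obj (DotCat.word (A :: (X ++ Y)))) := by
  refine (congrArg M.map ?_).trans (M.map_id _)
  refine congrArg DotCat.fn ?_
  ext i
  exact assoc_val [A] X Y i

theorem map_rightUnitor_word (A : S.Obj) :
    M.map (ρ_ (DotCat.word [A])).hom = 𝟙 (M.obj (DotCat.word [A])) := by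
  refine (congrArg M.map ?_).trans (M.map_id _)
  refine congrArg DotCat.fn ?_
  ext i; revert i
  refine join_cases (X := [A]) (Y := []) (fun i => ?_) (fun i => i.elim0)
  simp [Map.right, join]

end Lookup

/-! ### Matrices of morphisms between words, and their monoidality -/

section Matrices

variable {S : MonoidalSignature.{u, v}} {R : Type w} [CommSemiring R]
  (M : DotCat S ⥤ MatCat.{w, z} R) [M.Monoidal]

/-- The matrix of the value of a functor at a morphism between words. -/
def mat {X Y : List S.Obj} (f : DotCat.word X ⟶ DotCat.word Y) : wordObj M X ⟶ wordObj M Y :=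
  unsplit M X ≫ M.map f ≫ split M Y

theorem mat_id (X : List S.Obj) : mat M (𝟙 (DotCat.word X)) = 𝟙 (wordObj M X) := by
  simp [mat, unsplit_split]

theorem mat_comp {X Y Z : List S.Obj} (f : DotCat.word X ⟶ DotCat.word Y)
    (g : DotCat.word Y ⟶ DotCat.word Z) : mat M (f ≫ g) = mat M f ≫ mat M g := by
  simp only [mat, Functor.map_comp, Category.assoc]
  rw [← Category.assoc (split M Y), split_unsplit, Category.id_comp]

/-- The recursion ends in the unit object, so `wordObj M [A]` is `letterObj M A ⊗ 𝟙_`. Right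
unitality of `μ` identifies the comparison map, since the right unitor of a one-letter word is an
identity. -/
theorem unsplit_singleton (A : S.Obj) : unsplit M [A] = (ρ_ (letterObj M A)).hom := by
  refine Eq.trans ?_ (Functor.LaxMonoidal.right_unitality M (DotCat.word [A])).symm
  refine congrArg (letterObj M A ◁ ε M ≫ ·) ?_
  exact (Category.comp_id _).symm.trans
    (congrArg (μ M (DotCat.word [A]) (𝟙_ _) ≫ ·) (map_rightUnitor_word M A).symm)

theorem split_singleton (A : S.Obj) : split M [A] = (ρ_ (letterObj M A)).inv := by
  have h := split_unsplit M [A]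
  rw [unsplit_singleton] at h
  exact (Iso.comp_hom_eq_id (ρ_ (letterObj M A))).1 h

/-- Base case of `mu_split`, with arbitrary objects in place of words: left unitality of `μ`
together with `η ≫ ε = 𝟙`. -/
theorem mu_leftUnitor {T : DotCat S} {V : MatCat.{w, z} R} (t : M.obj T ⟶ V) :
    μ M (𝟙_ _) T ≫ M.map (λ_ T).hom ≫ t = (η M ⊗ₘ t) ≫ (λ_ V).hom := by
  rw [MonoidalCategory.tensorHom_def, Category.assoc, leftUnitor_naturality,
    Functor.LaxMonoidal.left_unitality M T, ← Category.assoc (η M ▷ _), ← comp_whiskerRight_assoc,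
    Functor.Monoidal.η_ε]
  simp

/-- Inductive step of `mu_split`: `P` is the new letter and `h` is the induction hypothesis for the
remaining words. The content is the associativity of `μ`. -/
theorem mu_associator {P Q T : DotCat S} {U V W : MatCat.{w, z} R} {s : M.obj Q ⟶ W}
    {t : M.obj T ⟶ V} {u : M.obj (Q ⊗ T) ⟶ U} {k : W ⊗ V ⟶ U}
    (h : μ M Q T ≫ u = (s ⊗ₘ t) ≫ k) :
    μ M (P ⊗ Q) T ≫ M.map (α_ P Q T).hom ≫ δ M P (Q ⊗ T) ≫ M.obj P ◁ u =
      ((δ M P Q ≫ M.obj P ◁ s) ⊗ₘ t) ≫ (α_ _ _ _).hom ≫ M.obj P ◁ k := by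
  have hα : μ M (P ⊗ Q) T ≫ M.map (α_ P Q T).hom = δ M P Q ▷ M.obj T ≫
      (α_ (M.obj P) (M.obj Q) (M.obj T)).hom ≫ M.obj P ◁ μ M Q T ≫ μ M P (Q ⊗ T) := by
    rw [← Functor.LaxMonoidal.associativity, ← comp_whiskerRight_assoc, Functor.Monoidal.δ_μ]
    simp
  rw [← Category.assoc, hα]
  simp only [Category.assoc, Functor.Monoidal.μ_δ_assoc]
  rw [← whiskerLeft_comp, h, whiskerLeft_comp]
  simp [MonoidalCategory.tensorHom_def]

/-- The comparison of the value at a concatenation with the product of the values. -/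
theorem mu_split : ∀ X Y : List S.Obj,
    μ M (DotCat.word X) (DotCat.word Y) ≫ split M (X ++ Y) =
      (split M X ⊗ₘ split M Y) ≫
        MatCat.fn (X := wordObj M X ⊗ wordObj M Y) (Y := wordObj M (X ++ Y)) (appendEquiv M X Y)
  | [], Y => by
    refine Eq.trans ?_ (mu_leftUnitor M (split M Y))
    refine congrArg (μ M (DotCat.word []) (DotCat.word Y) ≫ ·) ?_
    -- Inserts the image of the left unitor, which is an identity, to reach the form of
    -- `mu_leftUnitor`.
    exact (Category.id_comp _).symm.trans
      (congrArg (· ≫ split M Y) (map_leftUnitor_word M Y).symm)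
  | A :: X, Y => by
    refine Eq.trans ?_ ((mu_associator M (P := DotCat.word [A]) (mu_split X Y)).trans ?_)
    · refine congrArg (μ M (DotCat.word (A :: X)) (DotCat.word Y) ≫ ·) ?_
      exact (Category.id_comp _).symm.trans
        (congrArg (· ≫ split M (A :: (X ++ Y))) (map_associator_word M A X Y).symm)
    · refine congrArg ((split M (A :: X) ⊗ₘ split M Y) ≫ ·) ?_
      -- Reassociating and then appending below the first letter is the recursive clause of
      -- `append`.
      rw [MatCat.whiskerLeft_fn, MatCat.associator_hom, MatCat.fn_comp]
      rfl

/-- Indices of a concatenation are pairs of indices, as an isomorphism of matrices. -/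
abbrev appendIso (X Y : List S.Obj) : wordObj M X ⊗ wordObj M Y ≅ wordObj M (X ++ Y) :=
  MatCat.isoOfEquiv (X := wordObj M X ⊗ wordObj M Y) (appendEquiv M X Y)

theorem delta_split (X Y : List S.Obj) :
    δ M (DotCat.word X) (DotCat.word Y) ≫ (split M X ⊗ₘ split M Y) ≫ (appendIso M X Y).hom =
      split M (X ++ Y) := by
  refine (congrArg (δ M (DotCat.word X) (DotCat.word Y) ≫ ·) (mu_split M X Y)).symm.trans ?_
  exact Functor.Monoidal.δ_μ_assoc M (DotCat.word X) (DotCat.word Y) (split M (X ++ Y))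

/-- Both sides become the identity after composition with the isomorphism `(split M X ⊗ₘ split M Y)
≫ (appendIso M X Y).hom`, which may be cancelled. -/
theorem unsplit_delta (X Y : List S.Obj) :
    unsplit M (X ++ Y) ≫ δ M (DotCat.word X) (DotCat.word Y) =
      (appendIso M X Y).inv ≫ (unsplit M X ⊗ₘ unsplit M Y) := by
  have h1 : (split M X ⊗ₘ split M Y) ≫ (unsplit M X ⊗ₘ unsplit M Y) = 𝟙 _ := by
    rw [tensorHom_comp_tensorHom, split_unsplit, split_unsplit, id_tensorHom_id]
  have h2 : ((appendIso M X Y).inv ≫ (unsplit M X ⊗ₘ unsplit M Y)) ≫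
      (split M X ⊗ₘ split M Y) ≫ (appendIso M X Y).hom = 𝟙 _ := by
    rw [Category.assoc, ← Category.assoc (unsplit M X ⊗ₘ unsplit M Y), tensorHom_comp_tensorHom,
      unsplit_split, unsplit_split, id_tensorHom_id, Category.id_comp, Iso.inv_hom_id]
  have h3 : (unsplit M (X ++ Y) ≫ δ M (DotCat.word X) (DotCat.word Y)) ≫
      (split M X ⊗ₘ split M Y) ≫ (appendIso M X Y).hom = 𝟙 _ :=
    (Category.assoc _ _ _).trans
      ((congrArg (unsplit M (X ++ Y) ≫ ·) (delta_split M X Y)).trans (unsplit_split M (X ++ Y)))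
  have h4 : IsIso (split M X ⊗ₘ split M Y) :=
    ⟨_, h1, by rw [tensorHom_comp_tensorHom, unsplit_split, unsplit_split, id_tensorHom_id]⟩
  exact (cancel_mono _).1 (h3.trans h2.symm)

theorem mat_tensor {X Y X' Y' : List S.Obj} (f : DotCat.word X ⟶ DotCat.word Y)
    (g : DotCat.word X' ⟶ DotCat.word Y') :
    mat M (X := X ++ X') (Y := Y ++ Y') (f ⊗ₘ g) =
      (appendIso M X X').inv ≫ (mat M f ⊗ₘ mat M g) ≫ (appendIso M Y Y').hom := by
  have h : M.map (f ⊗ₘ g) = δ M _ _ ≫ (M.map f ⊗ₘ M.map g) ≫ μ M _ _ :=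
    Functor.Monoidal.map_tensor M f g
  have h' : (M.map f ⊗ₘ M.map g) ≫ μ M _ _ ≫ split M (Y ++ Y') =
      ((M.map f ≫ split M Y) ⊗ₘ (M.map g ≫ split M Y')) ≫ (appendIso M Y Y').hom := by
    rw [mu_split, ← tensorHom_comp_tensorHom, Category.assoc]
    rfl
  calc mat M (X := X ++ X') (Y := Y ++ Y') (f ⊗ₘ g)
      = unsplit M (X ++ X') ≫ (δ M _ _ ≫ (M.map f ⊗ₘ M.map g) ≫ μ M _ _) ≫ split M (Y ++ Y') :=
        congrArg (fun k => unsplit M (X ++ X') ≫ k ≫ split M (Y ++ Y')) h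
    _ = (unsplit M (X ++ X') ≫ δ M _ _) ≫ (M.map f ⊗ₘ M.map g) ≫ μ M _ _ ≫ split M (Y ++ Y') := by
        simp only [Category.assoc]
    _ = _ := by
        rw [h', unsplit_delta, mat, mat, ← tensorHom_comp_tensorHom (unsplit M X)]
        simp only [Category.assoc]

/-- The isomorphisms in `mat_tensor` come from bijections of indices, so they only split
concatenated indices, and the Kronecker product remains. -/
theorem mat_tensor_entry {X Y X' Y' : List S.Obj} (f : DotCat.word X ⟶ DotCat.word Y)
    (g : DotCat.word X' ⟶ DotCat.word Y') (x : wordObj M X) (x' : wordObj M X')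
    (y : wordObj M Y) (y' : wordObj M Y') :
    (mat M (X := X ++ X') (Y := Y ++ Y') (f ⊗ₘ g)).entry (append M X X' x x')
      (append M Y Y' y y') = (mat M f).entry x y * (mat M g).entry x' y' := by
  rw [mat_tensor, MatCat.isoOfEquiv_inv, MatCat.fn_comp_entry, MatCat.isoOfEquiv_hom,
    MatCat.fn_eq_cofn, MatCat.comp_cofn_entry, MatCat.tensorHom_entry]
  have hx : (appendEquiv M X X').symm (append M X X' x x') = (x, x') :=
    (appendEquiv M X X').symm_apply_apply (x, x')
  have hy : (appendEquiv M Y Y').symm (append M Y Y' y y') = (y, y') :=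
    (appendEquiv M Y Y').symm_apply_apply (y, y')
  rw [hx, hy]

end Matrices

end Contraction

/-! ### Frobenius and symmetry matrices in the presence of right unitors -/

namespace MatCat

variable {R : Type u} [CommSemiring R]

/-- In this and the next four lemmas, `u` and `s` stand for `unsplit` and `split` at a one-letter
word, `f`, `g` and `f'` for coherence maps of the functor and images of structure morphisms, and `h`
for the preservation axiom. The extra unitors come from the trailing unit in `wordObj`. -/
theorem cofn_point_rightUnitor {X U : MatCat.{u, w} R} {f : 𝟙_ (MatCat.{u, w} R) ⟶ U}
    {g : U ⟶ X} {s : X ⟶ X ⊗ 𝟙_ _} (h : f ≫ g = cofn (point X)) (hs : s = (ρ_ X).inv) :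
    f ≫ g ≫ s = cofn (X := 𝟙_ _) (Y := X ⊗ 𝟙_ _) fun _ => PUnit.unit := by
  rw [← Category.assoc, h, hs, rightUnitor_inv', cofn_comp]

theorem rightUnitor_fn_point {X U : MatCat.{u, w} R} {u : X ⊗ 𝟙_ _ ⟶ X} {f : X ⟶ U}
    {g : U ⟶ 𝟙_ (MatCat.{u, w} R)} (h : f ≫ g = fn (point X)) (hu : u = (ρ_ X).hom) :
    u ≫ f ≫ g = fn (X := X ⊗ 𝟙_ _) (Y := 𝟙_ _) fun _ => PUnit.unit := by
  rw [h, hu, rightUnitor_hom, fn_comp]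

theorem cofn_diag_rightUnitor {X U : MatCat.{u, w} R} {u : X ⊗ 𝟙_ _ ⟶ X} {f : X ⊗ X ⟶ U}
    {g : U ⟶ X} {s : X ⟶ X ⊗ 𝟙_ _} (h : f ≫ g = cofn (diag X)) (hu : u = (ρ_ X).hom)
    (hs : s = (ρ_ X).inv) :
    (X ◁ u ≫ f) ≫ g ≫ s = cofn (X := X ⊗ (X ⊗ 𝟙_ _)) (Y := X ⊗ 𝟙_ _)
      fun x => (x.1, x.1, PUnit.unit) := by
  have : (X ◁ u ≫ f) ≫ g ≫ s = X ◁ u ≫ (f ≫ g) ≫ s := by simp only [Category.assoc]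
  rw [this, h, hu, hs, rightUnitor_inv', rightUnitor_hom', whiskerLeft_cofn, cofn_comp, cofn_comp]
  rfl

theorem rightUnitor_fn_diag {X U : MatCat.{u, w} R} {u : X ⊗ 𝟙_ _ ⟶ X} {f : X ⟶ U}
    {g : U ⟶ X ⊗ X} {s : X ⟶ X ⊗ 𝟙_ _} (h : f ≫ g = fn (diag X)) (hu : u = (ρ_ X).hom)
    (hs : s = (ρ_ X).inv) :
    u ≫ f ≫ g ≫ X ◁ s = fn (X := X ⊗ 𝟙_ _) (Y := X ⊗ (X ⊗ 𝟙_ _))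
      fun x => (x.1, x.1, PUnit.unit) := by
  rw [← Category.assoc f, h, hu, hs, rightUnitor_inv, rightUnitor_hom, whiskerLeft_fn, fn_comp,
    fn_comp]
  rfl

theorem rightUnitor_braiding {X Y U V : MatCat.{u, w} R} {u : Y ⊗ 𝟙_ _ ⟶ Y}
    {f : X ⊗ Y ⟶ U} {g : U ⟶ V} {f' : V ⟶ Y ⊗ X} {s : X ⟶ X ⊗ 𝟙_ _}
    (h : f ≫ g ≫ f' = (β_ X Y).hom) (hu : u = (ρ_ Y).hom) (hs : s = (ρ_ X).inv) :
    (X ◁ u ≫ f) ≫ g ≫ f' ≫ Y ◁ s = fn (X := X ⊗ (Y ⊗ 𝟙_ _)) (Y := Y ⊗ (X ⊗ 𝟙_ _))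
      fun x => (x.2.1, x.1, PUnit.unit) := by
  have : (X ◁ u ≫ f) ≫ g ≫ f' ≫ Y ◁ s = X ◁ u ≫ (f ≫ g ≫ f') ≫ Y ◁ s := by
    simp only [Category.assoc]
  rw [this, h, hu, hs, rightUnitor_inv, rightUnitor_hom, braiding_hom, whiskerLeft_fn,
    whiskerLeft_fn, fn_comp, fn_comp]
  rfl

end MatCat

namespace Contraction

open Functor.LaxMonoidal Functor.OplaxMonoidal

/-! ### Values of box-free diagrams -/

section Wiring

variable {S : MonoidalSignature.{u, v}} {R : Type w} [CommSemiring R]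
  (M : DotCat S ⥤ MatCat.{w, z} R)

theorem pull_swap_singleton (A B : S.Obj) :
    pull M (Map.swap [A] [B]) = fun a => (a.2.1, a.1, PUnit.unit) := by
  refine funext fun ⟨b, a, _⟩ => (eq_pull M ?_).symm
  refine join_cases (fun i => ?_) (fun i => ?_)
  · obtain rfl : i = (0 : Fin 1) := Subsingleton.elim (α := Fin 1) _ _
    simp [Map.swap, -List.cons_append]
    rfl
  · obtain rfl : i = (0 : Fin 1) := Subsingleton.elim (α := Fin 1) _ _
    simp [Map.swap, -List.cons_append]
    rfl

theorem pull_fold_singleton (A : S.Obj) :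
    pull M (Map.fold [A]) = fun a => (a.1, a.1, PUnit.unit) := by
  refine funext fun ⟨a, _⟩ => (eq_pull M ?_).symm
  refine join_cases (fun i => ?_) (fun i => ?_)
  · obtain rfl : i = (0 : Fin 1) := Subsingleton.elim (α := Fin 1) _ _
    simp [Map.fold, -List.cons_append]
    rfl
  · obtain rfl : i = (0 : Fin 1) := Subsingleton.elim (α := Fin 1) _ _
    simp [Map.fold, -List.cons_append]
    rfl

/-- The matrices of the box-free diagrams along `r` are those of the restriction of indices. -/
structure PreservesWiring [M.Monoidal] {X Y : List S.Obj} (r : Map X Y) : Prop where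
  mat_fn : mat M (DotCat.fn (X := DotCat.word X) (Y := DotCat.word Y) r) = MatCat.cofn (pull M r)
  mat_cofn : mat M (DotCat.cofn (X := DotCat.word Y) (Y := DotCat.word X) r) = MatCat.fn (pull M r)

namespace PreservesWiring

section Monoidal

variable [M.Monoidal]

theorem id (X : List S.Obj) : PreservesWiring M (Map.id X) := by
  have h : pull M (Map.id X) = fun x => x := funext (pull_id M)
  constructor
  · rw [h]
    exact mat_id M X
  · rw [h]
    exact (congrArg (mat M) (DotCat.cofn_id (DotCat.word X))).trans (mat_id M X)

variable {M} in
theorem comp {X Y Z : List S.Obj} {r : Map X Y} {s : Map Y Z} (hr : PreservesWiring M r)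
    (hs : PreservesWiring M s) : PreservesWiring M (r.comp s) := by
  have h : pull M (r.comp s) = fun x => pull M r (pull M s x) := funext (pull_comp M r s)
  constructor
  · have := mat_comp M (DotCat.fn (X := DotCat.word X) (Y := DotCat.word Y) r)
      (DotCat.fn (X := DotCat.word Y) (Y := DotCat.word Z) s)
    rw [hr.mat_fn, hs.mat_fn, MatCat.cofn_comp, DotCat.fn_comp] at this
    rw [h]
    exact this
  · have := mat_comp M (DotCat.cofn (X := DotCat.word Z) (Y := DotCat.word Y) s)
      (DotCat.cofn (X := DotCat.word Y) (Y := DotCat.word X) r)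
    rw [hr.mat_cofn, hs.mat_cofn, MatCat.fn_comp, DotCat.cofn_comp] at this
    rw [h]
    exact this

variable {M} in
theorem sum {X Y X' Y' : List S.Obj} {r : Map X Y} {s : Map X' Y'} (hr : PreservesWiring M r)
    (hs : PreservesWiring M s) : PreservesWiring M (r.sum s) := by
  constructor
  · ext t t'
    obtain ⟨⟨x, x'⟩, rfl⟩ := (appendEquiv M X X').surjective t
    obtain ⟨⟨y, y'⟩, rfl⟩ := (appendEquiv M Y Y').surjective t'
    have h := mat_tensor_entry M (DotCat.fn (X := DotCat.word X) (Y := DotCat.word Y) r)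
      (DotCat.fn (X := DotCat.word X') (Y := DotCat.word Y') s) x x' y y'
    rw [hr.mat_fn, hs.mat_fn, MatCat.cofn_entry, MatCat.cofn_entry, MatCat.ite_mul_ite] at h
    refine Eq.trans ?_ (h.trans ?_)
    · exact congrArg (fun k => (mat M (X := X ++ X') (Y := Y ++ Y') k).entry _ _)
        (DotCat.fn_tensor _ _).symm
    · rw [MatCat.cofn_entry]
      refine if_congr ?_ rfl rfl
      -- Concatenation of indices is injective, so the product of the two deltas is the delta of the
      -- concatenated indices.
      rw [← (appendEquiv M X X').injective.eq_iff]
      exact Eq.congr_right (pull_sum M r s y y').symm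
  · ext t t'
    obtain ⟨⟨x, x'⟩, rfl⟩ := (appendEquiv M X X').surjective t'
    obtain ⟨⟨y, y'⟩, rfl⟩ := (appendEquiv M Y Y').surjective t
    have h := mat_tensor_entry M (DotCat.cofn (X := DotCat.word Y) (Y := DotCat.word X) r)
      (DotCat.cofn (X := DotCat.word Y') (Y := DotCat.word X') s) y y' x x'
    rw [hr.mat_cofn, hs.mat_cofn, MatCat.fn_entry, MatCat.fn_entry, MatCat.ite_mul_ite] at h
    refine Eq.trans ?_ (h.trans ?_)
    · exact congrArg (fun k => (mat M (X := Y ++ Y') (Y := X ++ X') k).entry _ _)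
        (DotCat.cofn_tensor _ _).symm
    · rw [MatCat.fn_entry]
      refine if_congr ?_ rfl rfl
      rw [← (appendEquiv M X X').injective.eq_iff]
      exact Eq.congr_left (pull_sum M r s y y').symm

end Monoidal

section Swap

variable [M.Braided]

theorem map_braiding (A B : S.Obj) :
    μ M (DotCat.word [A]) (DotCat.word [B]) ≫
      M.map (β_ (DotCat.word [A]) (DotCat.word [B])).hom ≫
        δ M (DotCat.word [B]) (DotCat.word [A]) = (β_ (letterObj M A) (letterObj M B)).hom := by
  have h := Functor.LaxBraided.braided (F := M) (DotCat.word [A]) (DotCat.word [B])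
  rw [← Category.assoc, h, Category.assoc, Functor.Monoidal.μ_δ, Category.comp_id]

theorem mat_braiding (A B : S.Obj) :
    mat M (X := [A, B]) (Y := [B, A]) (β_ (DotCat.word [A]) (DotCat.word [B])).hom =
      MatCat.fn (X := wordObj M [A, B]) (Y := wordObj M [B, A])
        fun a => (a.2.1, a.1, PUnit.unit) :=
  MatCat.rightUnitor_braiding (map_braiding M A B) (unsplit_singleton M B) (split_singleton M A)

/-- The braiding is both the `fn` of one swap and the `cofn` of the opposite swap, so the single
matrix `mat_braiding` settles both halves. -/
theorem swap_singleton (A B : S.Obj) : PreservesWiring M (Map.swap [A] [B]) := by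
  constructor
  · rw [pull_swap_singleton]
    refine (mat_braiding M A B).trans ?_
    exact MatCat.fn_eq_cofn (X := wordObj M [A, B]) (Y := wordObj M [B, A])
      ⟨fun a => (a.2.1, a.1, PUnit.unit), fun a => (a.2.1, a.1, PUnit.unit), fun _ => rfl,
        fun _ => rfl⟩
  · rw [pull_swap_singleton]
    refine Eq.trans ?_ (mat_braiding M B A)
    exact congrArg (mat M (X := [B, A]) (Y := [A, B])) (DotCat.braiding_hom' _ _).symm

end Swap

section Hypergraph

variable [M.Braided] [IsHypergraphFunctor M]

theorem empty_singleton (A : S.Obj) : PreservesWiring M (Map.empty [A]) where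
  mat_fn := MatCat.cofn_point_rightUnitor
    (IsHypergraphFunctor.map_one (M := M) (DotCat.word [A])) (split_singleton M A)
  mat_cofn := MatCat.rightUnitor_fn_point
    (IsHypergraphFunctor.map_counit (M := M) (DotCat.word [A])) (unsplit_singleton M A)

theorem fold_singleton (A : S.Obj) : PreservesWiring M (Map.fold [A]) where
  mat_fn := (MatCat.cofn_diag_rightUnitor
    (IsHypergraphFunctor.map_mul (M := M) (DotCat.word [A])) (unsplit_singleton M A)
    (split_singleton M A)).trans (congrArg MatCat.cofn (pull_fold_singleton M A).symm)
  mat_cofn := (MatCat.rightUnitor_fn_diag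
    (IsHypergraphFunctor.map_comul (M := M) (DotCat.word [A])) (unsplit_singleton M A)
    (split_singleton M A)).trans (congrArg MatCat.fn (pull_fold_singleton M A).symm)

/-- The empty map into a word is the concatenation of the empty maps into its letters, to which
preservation of units and counits applies. -/
theorem empty : ∀ X : List S.Obj, PreservesWiring M (Map.empty X)
  | [] => by
    have h : Map.empty ([] : List S.Obj) = Map.id [] := Map.ext fun i => i.elim0
    rw [h]
    exact id M []
  | A :: X => by
    have h : Map.empty (A :: X) = (Map.empty [A]).sum (Map.empty X) := Map.ext fun i => i.elim0
    rw [h]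
    exact (empty_singleton M A).sum (empty X)

/-- Merging a letter into a position of a word that carries the same letter. -/
theorem merge : ∀ (Y : List S.Obj) (A : S.Obj) (t : Map [A] Y),
    PreservesWiring M (X := [A] ++ Y) (t.elim (Map.id Y))
  | [], A, t => (t (0 : Fin 1)).elim0
  | B :: Y, A, t => by
    obtain ⟨j, hj⟩ : ∃ j : Fin (Y.length + 1), t (0 : Fin 1) = j := ⟨_, rfl⟩
    have hl : letter (B :: Y) j = A := hj ▸ t.letter_toFun (0 : Fin 1)
    have hn : ∀ i : Pos [A], i = (0 : Fin 1) := fun i => Subsingleton.elim (α := Fin 1) _ _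
    -- `hA`, `hB` and `hY` translate positions of `A :: B :: Y` between the bracketings `[A] ++ ([B]
    -- ++ Y)` and `([A] ++ [B]) ++ Y`.
    have hA : ∀ (A B : S.Obj) (i : Pos [A]), join [A] (B :: Y) (Sum.inl i) =
      join [A, B] Y (Sum.inl (join [A] [B] (Sum.inl i))) := fun A B i => rfl
    have hB : ∀ (A B : S.Obj) (i : Pos [B]), join [A] (B :: Y) (Sum.inr (join [B] Y (Sum.inl i))) =
      join [A, B] Y (Sum.inl (join [A] [B] (Sum.inr i))) := fun A B i => rfl
    have hY : ∀ (A B : S.Obj) (i : Pos Y), join [A] (B :: Y) (Sum.inr (join [B] Y (Sum.inr i))) =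
      join [A, B] Y (Sum.inr i) := fun A B i => Fin.ext (by simp [join])
    induction j using Fin.cases with
    -- The target is the first letter: fold the two copies and leave `Y` alone.
    | zero =>
      obtain rfl : B = A := hl
      have h : t.elim (Map.id (B :: Y)) = (Map.fold [B]).sum (Map.id Y) := by
        ext i; congr 1; revert i
        refine join_cases (X := [B]) (fun i => ?_)
          (join_cases (X := [B]) (fun i => ?_) (fun i => ?_))
        · refine Eq.trans (b := t i) (by simp) ?_
          rw [hA, hn i, hj]
          simp [Map.fold, -List.cons_append]
          rfl
        · refine Eq.trans (b := join [B] Y (Sum.inl i)) (by simp) ?_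
          rw [hB]
          simp [Map.fold, -List.cons_append]
        · refine Eq.trans (b := join [B] Y (Sum.inr i)) (by simp) ?_
          rw [hY]
          simp [Map.fold, -List.cons_append]
      rw [h]
      exact (fold_singleton M B).sum (id M Y)
    -- The target lies in `Y`: swap the new letter past `B`, then merge it into the shorter word.
    | succ j =>
      let t' : Map [A] Y := ⟨fun _ => j, fun i => by rw [hn i]; exact hl⟩
      have h : t.elim (Map.id (B :: Y)) = ((Map.swap [A] [B]).sum (Map.id Y)).comp
          ((Map.id [B]).sum (t'.elim (Map.id Y))) := by
        ext i; congr 1; revert i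
        refine join_cases (X := [A]) (fun i => ?_)
          (join_cases (X := [B]) (fun i => ?_) (fun i => ?_))
        · refine Eq.trans (b := t i) (by simp) ?_
          rw [hA, hn i, hj]
          simp [Map.swap, -List.cons_append, ← hB]
          exact ((join_cons_inr B [] Y j).trans (congrArg Fin.succ (join_nil_inr Y j))).symm
        · refine Eq.trans (b := join [B] Y (Sum.inl i)) (by simp) ?_
          rw [hB]
          simp [Map.swap, -List.cons_append, ← hA]
        · refine Eq.trans (b := join [B] Y (Sum.inr i)) (by simp) ?_
          rw [hY]
          simp [-List.cons_append]
          rw [← hY B A]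
          simp
      rw [h]
      exact ((swap_singleton M A B).sum (id M Y)).comp ((id M [B]).sum (merge Y A t'))

/-- Induction on the source: send all letters but the first into `Y` while keeping the first in
front, then merge it into the position that `r` prescribes. -/
theorem of_map : ∀ (X Y : List S.Obj) (r : Map X Y), PreservesWiring M r
  | [], Y, r => by
    have h : r = Map.empty Y := Map.ext fun i => i.elim0
    rw [h]
    exact empty M Y
  | A :: X, Y, r => by
    have h : r = ((Map.id [A]).sum ((Map.inr [A] X).comp r)).comp
        (((Map.inl [A] X).comp r).elim (Map.id Y)) := by
      ext i; congr 1; revert i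
      refine join_cases (X := [A]) (fun i => ?_) (fun i => ?_) <;> simp [-List.cons_append]
    rw [h]
    exact ((id M [A]).sum (of_map X Y _)).comp (merge M Y A _)

end Hypergraph

end PreservesWiring

end Wiring

end Contraction

/-! ### Layers of boxes and their decomposition -/

namespace DotDiagram

variable {S : MonoidalSignature.{u, v}}

/-- The diagram with one dot for each position of `Z`, all of them diagram inputs and outputs, and
with boxes indexed by `I` that are wired along given maps of positions. -/
@[simps] abbrev layer {Z : List S.Obj} (I : Type) [Finite I] (f : I → S.Mor)
    (r : ∀ i, Map (S.dom (f i)) Z) (s : ∀ i, Map (S.cod (f i)) Z) : DotDiagram S Z Z where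
  Box := I
  Dot := Pos Z
  finite_box := inferInstance
  finite_dot := inferInstance
  boxLabel := f
  dotLabel := letter Z
  boxIn b i := r b i
  boxOut b j := s b j
  inp i := i
  out j := j
  dotLabel_boxIn b i := (r b).letter_toFun i
  dotLabel_boxOut b j := (s b).letter_toFun j
  dotLabel_inp _ := rfl
  dotLabel_out _ := rfl

theorem layer_reindex {Z : List S.Obj} {I J : Type} [Finite I] [Finite J] (e : I ≃ J)
    (f : J → S.Mor) (r : ∀ i, Map (S.dom (f i)) Z) (s : ∀ i, Map (S.cod (f i)) Z) :
    layer I (fun i => f (e i)) (fun i => r (e i)) (fun i => s (e i)) ≈ layer J f r s :=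
  ⟨⟨e, .refl _, fun _ => rfl, fun _ => rfl, fun _ _ => rfl, fun _ _ => rfl, fun _ => rfl,
    fun _ => rfl⟩⟩

theorem layer_empty {Z : List S.Obj} {I : Type} [Finite I] [IsEmpty I] (f : I → S.Mor)
    (r : ∀ i, Map (S.dom (f i)) Z) (s : ∀ i, Map (S.cod (f i)) Z) :
    layer I f r s ≈ fn (Map.id Z) :=
  ⟨⟨Equiv.equivOfIsEmpty _ _, .refl _, fun b => isEmptyElim b, fun _ => rfl,
    fun b => isEmptyElim b, fun b => isEmptyElim b, fun _ => rfl, fun _ => rfl⟩⟩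

/-- A layer preceded by a box whose inputs are wired to the dots of the layer and whose outputs are
wired to dots of their own. -/
@[simps] abbrev openLayer {Z : List S.Obj} (I : Type) [Finite I] (f : Option I → S.Mor)
    (r : ∀ i, Map (S.dom (f i)) Z) (s : ∀ i, Map (S.cod (f i)) Z) :
    DotDiagram S Z (S.cod (f none) ++ Z) where
  Box := Option I
  Dot := Pos (S.cod (f none)) ⊕ Pos Z
  finite_box := inferInstance
  finite_dot := inferInstance
  boxLabel := f
  dotLabel := Sum.elim (letter _) (letter Z)
  boxIn b i := Sum.inr (r b i)
  boxOut
    | none, j => Sum.inl j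
    | some b, j => Sum.inr (s (some b) j)
  inp i := Sum.inr i
  out j := (join _ Z).symm j
  dotLabel_boxIn b i := (r b).letter_toFun i
  dotLabel_boxOut := by
    rintro (_ | b) j
    · rfl
    · exact (s (some b)).letter_toFun j
  dotLabel_inp _ := rfl
  dotLabel_out := join_cases (fun i => by simp) (fun i => by simp)

variable {Z : List S.Obj} {I : Type} [Finite I] (f : Option I → S.Mor)
    (r : ∀ i, Map (S.dom (f i)) Z) (s : ∀ i, Map (S.cod (f i)) Z)

/-- The `cofn` copies the dots that feed the box `none` and passes all dots on to the layer. In the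
pushout the input dots of that box are absorbed by the dots of `Z`, while its output dots stay
separate. -/
theorem cofn_comp_box_tensor_layer :
    comp (cofn ((r none).elim (Map.id Z)))
      (tensor (box S (f none))
        (layer I (fun i => f (some i)) (fun i => r (some i)) (fun i => s (some i)))) ≈
      openLayer I f r s := by
  let F : DotDiagram S Z _ := cofn ((r none).elim (Map.id Z))
  let G := tensor (box S (f none))
    (layer I (fun i => f (some i)) (fun i => r (some i)) (fun i => s (some i)))
  refine ⟨compIso (F := F) (G := G)
    ⟨Sum.elim Empty.elim (Sum.elim (fun _ => none) some),
      fun b => b.elim (Sum.inr (Sum.inl ())) (fun i => Sum.inr (Sum.inr i)), ?_, ?_⟩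
    -- The quotient map on dots: the two copies of `Z` are identified, and the `i`-th input dot of
    -- the box goes to the dot `r none i`.
    (Sum.elim Sum.inr (Sum.elim (Sum.elim (fun i => Sum.inr (r none i)) Sum.inl) Sum.inr))
    (Sum.elim (fun j => Quot.mk _ (Sum.inr (Sum.inl (Sum.inr j))))
      (fun z => Quot.mk _ (Sum.inl z))) ?_ ?_ ?_ ?_ ?_ ?_ ?_ ?_ ?_ ?_ ?_⟩
  · rintro (b | b | b)
    · exact b.elim
    · rfl
    · rfl
  · rintro (_ | b) <;> rfl
  · exact join_cases (fun i => by simp [F, G]) (fun i => by simp [F, G])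
  · rintro (j | z)
    · exact ⟨Sum.inr (Sum.inl (Sum.inr j)), rfl⟩
    · exact ⟨Sum.inl z, rfl⟩
  · rintro (z | (i | j) | z)
    · rfl
    · simpa [F, G] using mk_glue F G (join _ _ (Sum.inl i))
    · rfl
    · simpa [F, G] using mk_glue F G (join _ _ (Sum.inr z))
  · rintro (b | b | b)
    · exact b.elim
    · rfl
    · rfl
  · rintro (z | (i | j) | z) <;> simp [F, G]
  · exact fun b => b.elim
  · rintro (b | b) i <;> rfl
  · exact fun b => b.elim
  · rintro (b | b) i <;> rfl
  · intro i; rfl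
  · refine join_cases (fun i => ?_) (fun i => ?_) <;> simp [G]

/-- The `fn` glues the remaining free output dots of the box `none` to the dots prescribed by `s
none`. -/
theorem openLayer_comp_fn :
    comp (openLayer I f r s) (fn ((s none).elim (Map.id Z))) ≈ layer (Option I) f r s := by
  let F := openLayer I f r s
  let G : DotDiagram S _ Z := fn ((s none).elim (Map.id Z))
  refine ⟨compIso (F := F) (G := G) (Equiv.sumEmpty _ Empty)
    (Sum.elim (Sum.elim (s none) _root_.id) _root_.id) (fun z => Quot.mk _ (Sum.inr z))
    ?_ (fun z => ⟨Sum.inr z, rfl⟩) ?_ ?_ ?_ ?_ ?_ ?_ ?_ ?_ ?_⟩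
  · exact join_cases (fun i => by simp [F, G]) (fun i => by simp [F, G])
  · rintro ((j | z) | z)
    · simpa [F, G] using (mk_glue F G (join _ _ (Sum.inl j))).symm
    · simpa [F, G] using (mk_glue F G (join _ _ (Sum.inr z))).symm
    · rfl
  · rintro (b | b)
    · rfl
    · exact b.elim
  · rintro ((j | z) | z) <;> simp [F, G]
  · rintro b i; rfl
  · exact fun b => b.elim
  · rintro (_ | b) i <;> rfl
  · exact fun b => b.elim
  · intro i; rfl
  · intro i; rfl

end DotDiagram

namespace Contraction

/-! ### Matrices of layers -/

section Layers

variable {S : MonoidalSignature.{u, v}} {R : Type w} [CommSemiring R]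
  (M : DotCat S ⥤ MatCat.{w, z} R) [M.Braided] [IsHypergraphFunctor M]

/-- The wiring before and after the parallel product only substitutes indices: its entry is taken at
the rows `pull M (r none) x` and `x`, and at the columns `pull M (s none) y` and `y`. The Kronecker
product then splits off the factor of the new box. -/
theorem mat_layer_option {Z : List S.Obj} {I : Type} [Finite I] (f : Option I → S.Mor)
    (r : ∀ i, Map (S.dom (f i)) Z) (s : ∀ i, Map (S.cod (f i)) Z) (x y : wordObj M Z) :
    (mat M (X := Z) (Y := Z) (DotHom.mk (DotDiagram.layer (Option I) f r s))).entry x y =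
      (mat M (DotCat.box (f none))).entry (pull M (r none) x) (pull M (s none) y) *
        (mat M (X := Z) (Y := Z) (DotHom.mk (DotDiagram.layer I (fun i => f (some i))
          (fun i => r (some i)) (fun i => s (some i))))).entry x y := by
  let g : DotCat.word Z ⟶ DotCat.word Z := DotHom.mk (DotDiagram.layer I (fun i => f (some i))
    (fun i => r (some i)) (fun i => s (some i)))
  let p : DotCat.word Z ⟶ DotCat.word (S.dom (f none) ++ Z) :=
    DotCat.cofn ((r none).elim (Map.id Z))
  let q : DotCat.word (S.cod (f none) ++ Z) ⟶ DotCat.word Z :=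
    DotCat.fn ((s none).elim (Map.id Z))
  let t : DotCat.word (S.dom (f none) ++ Z) ⟶ DotCat.word (S.cod (f none) ++ Z) :=
    DotCat.box (f none) ⊗ₘ g
  have h1 : p ≫ t = DotHom.mk (DotDiagram.openLayer I f r s) :=
    Quotient.sound (DotDiagram.cofn_comp_box_tensor_layer f r s)
  have h2 : (p ≫ t) ≫ q = DotHom.mk (DotDiagram.layer (Option I) f r s) := by
    rw [h1]
    exact Quotient.sound (DotDiagram.openLayer_comp_fn f r s)
  have hp : mat M p = _ := (PreservesWiring.of_map M _ _ ((r none).elim (Map.id Z))).mat_cofn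
  have hq : mat M q = _ := (PreservesWiring.of_map M _ _ ((s none).elim (Map.id Z))).mat_fn
  rw [← h2, mat_comp, mat_comp, hp, hq, MatCat.comp_cofn_entry, MatCat.fn_comp_entry, pull_elim,
    pull_elim, pull_id, pull_id]
  exact mat_tensor_entry M (DotCat.box (f none)) g _ _ _ _

/-- Induction on the set of boxes. The delta is the identity matrix of the layer without boxes; it
makes the matrix diagonal although inputs are read from `x` and outputs from `y`. -/
theorem mat_layer {Z : List S.Obj} (I : Type) [Fintype I] : ∀ (f : I → S.Mor)
    (r : ∀ i, Map (S.dom (f i)) Z) (s : ∀ i, Map (S.cod (f i)) Z) (x y : wordObj M Z),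
    (mat M (X := Z) (Y := Z) (DotHom.mk (DotDiagram.layer I f r s))).entry x y =
      (∏ i, (mat M (DotCat.box (f i))).entry (pull M (r i) x) (pull M (s i) y)) *
        if x = y then 1 else 0 := by
  refine Fintype.induction_empty_option (P := fun I _ => ∀ (f : I → S.Mor)
    (r : ∀ i, Map (S.dom (f i)) Z) (s : ∀ i, Map (S.cod (f i)) Z) (x y : wordObj M Z),
    (mat M (X := Z) (Y := Z) (DotHom.mk (DotDiagram.layer I f r s))).entry x y =
      (∏ i, (mat M (DotCat.box (f i))).entry (pull M (r i) x) (pull M (s i) y)) *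
        if x = y then 1 else 0) ?_ ?_ ?_ I
  · intro I J _ e ih f r s x y
    let _ := Fintype.ofEquiv J e.symm
    have h : DotHom.mk (DotDiagram.layer J f r s) = DotHom.mk (DotDiagram.layer I
      (fun i => f (e i)) (fun i => r (e i)) (fun i => s (e i))) :=
      (Quotient.sound (DotDiagram.layer_reindex e f r s)).symm
    rw [h, ih]
    exact congrArg (· * ite (x = y) (1 : R) 0) (e.prod_comp fun j =>
      (mat M (DotCat.box (f j))).entry (pull M (r j) x) (pull M (s j) y))
  · intro f r s x y
    have h : DotHom.mk (DotDiagram.layer PEmpty f r s) = 𝟙 (DotCat.word Z) :=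
      Quotient.sound (DotDiagram.layer_empty f r s)
    rw [h, mat_id, MatCat.id_entry]
    simp
  · intro I _ ih f r s x y
    rw [mat_layer_option, ih, Fintype.prod_option, mul_assoc]

end Layers

/-! ### Closed diagrams as sums over the indices of their dots -/

section Closed

variable {S : MonoidalSignature.{u, v}} {R : Type w} [CommSemiring R]
  (M : DotCat S ⥤ MatCat.{w, z} R)

/-- The indexing functions of a diagram are the indices of a word that lists its dots. -/
theorem sum_idx {X Y : List S.Obj} (F : DotDiagram S X Y) [Fintype F.Dot] [DecidableEq F.Dot]
    {Z : List S.Obj} (e : F.Dot ≃ Pos Z) (he : ∀ d, letter Z (e d) = F.dotLabel d)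
    (g : wordObj M Z → R) (k : Idx M F → R)
    (h : ∀ (φ : Idx M F) (x : wordObj M Z),
      (∀ d, look M Z x (e d) = ⟨F.dotLabel d, φ d⟩) → g x = k φ) :
    ∑ x, g x = ∑ φ, k φ := by
  -- The bijection that reads an indexing function in the order of the word `Z`. The hypothesis `h`
  -- is phrased through `look`, so the transports hidden in `E` do not appear in it.
  let E : Idx M F → wordObj M Z := fun φ =>
    ofLook M Z (fun i => ⟨F.dotLabel (e.symm i), φ (e.symm i)⟩)
      fun i => (he _).symm.trans (congrArg (letter Z) (e.apply_symm_apply i))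
  have hE : ∀ φ d, look M Z (E φ) (e d) = ⟨F.dotLabel d, φ d⟩ := fun φ d => by
    rw [look_ofLook, e.symm_apply_apply]
  refine (Fintype.sum_bijective E ⟨fun φ ψ hφ => funext fun d => ?_, fun x => ?_⟩ _ _
    fun φ => (h φ (E φ) (hE φ)).symm).symm
  · have := (hE φ d).symm.trans ((congrArg (fun t => look M Z t (e d)) hφ).trans (hE ψ d))
    exact eq_of_heq (Sigma.mk.inj this).2
  -- The preimage of `x` takes at each dot the component of `x` at the position of that dot.
  · let φ : Idx M F := fun d =>
      castIndex M ((look_fst M Z x (e d)).trans (he d)) (look M Z x (e d)).2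
    refine ⟨φ, look_injective M Z (funext fun i => ?_)⟩
    obtain ⟨d, rfl⟩ := e.surjective i
    exact (hE φ d).trans (mk_castIndex M _ _)

variable [M.Braided] [IsHypergraphFunctor M]

/-- Without boundary, `F` is a layer on the word of its dots, closed off by the unit and the counit.
These contribute only ones, so the diagonal entries of the layer are summed. -/
theorem scalar_closed (F : DotDiagram S [] []) [Fintype F.Box] {Z : List S.Obj}
    (e : F.Dot ≃ Pos Z) (he : ∀ d, letter Z (e d) = F.dotLabel d) :
    scalar M F.toScalar = ∑ x : wordObj M Z, ∏ b, (mat M (DotCat.box (F.boxLabel b))).entry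
      (pull M ⟨fun i => e (F.boxIn b i), fun i => by rw [he, F.dotLabel_boxIn]⟩ x)
      (pull M ⟨fun i => e (F.boxOut b i), fun i => by rw [he, F.dotLabel_boxOut]⟩ x) := by
  let G := DotDiagram.layer F.Box F.boxLabel
    (fun b => ⟨fun i => e (F.boxIn b i), fun i => by rw [he, F.dotLabel_boxIn]⟩)
    (fun b => ⟨fun i => e (F.boxOut b i), fun i => by rw [he, F.dotLabel_boxOut]⟩)
  have hF : F ≈ DotDiagram.pre (Map.empty Z) (DotDiagram.post G (Map.empty Z)) :=
    ⟨⟨.refl _, e, fun _ => rfl, he, fun _ _ => rfl, fun _ _ => rfl, fun i => i.elim0,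
      fun i => i.elim0⟩⟩
  let p : DotCat.word [] ⟶ DotCat.word Z := DotCat.fn (Map.empty Z)
  let q : DotCat.word Z ⟶ DotCat.word [] := DotCat.cofn (Map.empty Z)
  let g : DotCat.word Z ⟶ DotCat.word Z := DotHom.mk G
  have h : F.toScalar = p ≫ g ≫ q := by
    refine (Quotient.sound hF).trans ?_
    refine (DotHom.fn_comp_mk _ _).symm.trans ?_
    exact congrArg (p ≫ ·) (DotHom.mk_comp_cofn G (Map.empty Z)).symm
  have hp : mat M p = _ := (PreservesWiring.empty M Z).mat_fn
  have hq : mat M q = _ := (PreservesWiring.empty M Z).mat_cofn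
  -- There is only one index of the empty word, so the deltas in the matrices of `p` and `q` are
  -- always `1`.
  have : Subsingleton (wordObj M []) := inferInstanceAs (Subsingleton PUnit)
  have hs : ∀ o o' : wordObj M [], (mat M (X := []) (Y := []) (p ≫ g ≫ q)).entry o o' =
      ∑ x, (mat M g).entry x x := by
    intro o o'
    rw [mat_comp, mat_comp, hp, hq, MatCat.comp_entry]
    refine Finset.sum_congr rfl fun x _ => ?_
    rw [MatCat.comp_entry, Finset.sum_eq_single x]
    · have h1 : (MatCat.cofn (pull M (Map.empty Z)) : wordObj M [] ⟶ wordObj M Z).entry o x = 1 :=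
        (MatCat.cofn_entry _ _ _).trans (if_pos (Subsingleton.elim _ _))
      have h2 : (MatCat.fn (pull M (Map.empty Z)) : wordObj M Z ⟶ wordObj M []).entry x o' = 1 :=
        (MatCat.fn_entry _ _ _).trans (if_pos (Subsingleton.elim _ _))
      exact (congrArg₂ (fun a b : R => a * ((mat M g).entry x x * b)) h1 h2).trans
        ((one_mul _).trans (mul_one _))
    · intro y _ hy
      have h0 : (mat M g).entry x y = 0 := by
        refine (mat_layer M F.Box _ _ _ x y).trans ?_
        rw [if_neg hy.symm, mul_zero]
      rw [h0, zero_mul]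
    · exact fun hx => absurd (Finset.mem_univ x) hx
  -- At the empty word, `unsplit` and `split` are `ε` and `η` by definition.
  have h' : scalar M F.toScalar = (mat M (X := []) (Y := []) F.toScalar).entry
    PUnit.unit PUnit.unit := rfl
  rw [h', h]
  refine (hs _ _).trans ?_
  refine Finset.sum_congr rfl fun x _ => (mat_layer M F.Box _ _ _ x x).trans ?_
  rw [if_pos rfl, mul_one]

end Closed

end Contraction

/-! ### The contraction formula -/

theorem mainTheorem6 {S : MonoidalSignature.{u, v}} {R : Type w} [CommSemiring R]
    (M : DotCat S ⥤ MatCat.{w, z} R) [M.Braided] [IsHypergraphFunctor M]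
    (F : DotDiagram S [] []) [Fintype F.Box] [Fintype F.Dot] [DecidableEq F.Dot]
    (hF : F.IsSimple) :
    Contraction.scalar M F.toScalar =
      ∑ φ : Contraction.Idx M F, ∏ b : F.Box,
        Contraction.boxEntry M (F.boxLabel b)
          (fun i => Contraction.castIndex M (F.dotLabel_boxIn b i) (φ (F.boxIn b i)))
          (fun j => Contraction.castIndex M (F.dotLabel_boxOut b j) (φ (F.boxOut b j))) := by
  let e₀ := Fintype.equivFin F.Dot
  -- An arbitrary ordering of the dots turns them into the positions of a word; the resulting sum
  -- over indexing functions no longer refers to it.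
  let Z := List.ofFn fun i => F.dotLabel (e₀.symm i)
  let e : F.Dot ≃ Pos Z := e₀.trans (finCongr List.length_ofFn.symm)
  have he : ∀ d, letter Z (e d) = F.dotLabel d := fun d => by
    simp [letter, Z, e]
  rw [Contraction.scalar_closed M F e he]
  refine Contraction.sum_idx M F e he _ _ fun φ x hx => Finset.prod_congr rfl fun b _ => ?_
  -- `boxEntry` is by definition an entry of `mat` at the tuples of values of `φ`. Those tuples are
  -- the restrictions of `x` along the wiring of `b`, which is checked position by position.
  refine congrArg₂ (Contraction.mat M (DotCat.box (F.boxLabel b))).entry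
    (Contraction.eq_pull M fun i => ?_).symm (Contraction.eq_pull M fun j => ?_).symm
  · rw [Contraction.look_tuple, Contraction.mk_castIndex]
    exact (hx _).symm
  · rw [Contraction.look_tuple, Contraction.mk_castIndex]
    exact (hx _).symm
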